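/- Let $\lambda$ denote Lebesgue measure on $\mathbb R$. A set $C\subseteq\mathbb R$ is called symmetric if there is a real number $c$ such that, for all real $x$, $c+x\in C$ if and only if $c-x\in C$. For $0<\varepsilon\le 1$ let $$\Delta(\varepsilon)=\sup\{\delta\ge 0:\ \text{every measurable } A\subseteq[0,1)\text{ with }\lambda(A)=\varepsilon\text{ contains a measurable symmetric subset } C \text{ with }\lambda(C)=\delta\}.$$ Then: (i) $\Delta(\varepsilon)=2\varepsilon-1$ for $\frac{11}{16}\le\varepsilon\le1$, and $\Delta(\varepsilon)\ge 2\varepsilon-1$ for $\frac12\le\varepsilon\le\frac{11}{16}$; (ii) $\Delta(\varepsilon)\ge 0.591389\,\varepsilon^2$ for all $0<\varepsilon\le1$; (iii) $\Delta(\varepsilon)\ge 0.5546\,\varepsilon^2+0.088079\,\varepsilon^3$ for all $0<\varepsilon\le1$; (iv) $\Delta(\varepsilon)\le\frac{96}{121}\varepsilon^2<0.7934\,\varepsilon^2$ for all $0<\varepsilon\le\frac{11}{16}$; (v) $\Delta(\varepsilon)\le\dfrac{\pi\varepsilon^2}{(1+\sqrt{1-\varepsilon})^2}$ for all $0<\varepsilon\le1$,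 and $\dfrac{\pi\varepsilon^2}{(1+\sqrt{1-\varepsilon})^2}=\frac{\pi}{4}\varepsilon^2+O(\varepsilon^3)$, where the implied constant is absolute and the estimate holds uniformly for $0<\varepsilon\le1$. -/

import Mathlib

open MeasureTheory

/-- A set of reals is symmetric if it is invariant under some reflection `c + x ↦ c - x`. -/
def IsSymmetricSet (C : Set ℝ) : Prop :=
  ∃ c : ℝ, ∀ x : ℝ, c + x ∈ C ↔ c - x ∈ C

/-- The numbers `δ ≥ 0` such that every measurable subset of `[0,1)` with measure `ε` contains a
symmetric subset with measure `δ`. Measurable means Lebesgue measurable, that is, null-measurable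
for `volume`. -/
def guaranteedMeasures (ε : ℝ) : Set ℝ :=
  {δ : ℝ | 0 ≤ δ ∧ ∀ A : Set ℝ, A ⊆ Set.Ico (0 : ℝ) 1 → NullMeasurableSet A volume →
    volume A = ENNReal.ofReal ε →
      ∃ C : Set ℝ, C ⊆ A ∧ IsSymmetricSet C ∧ NullMeasurableSet C volume ∧
        volume C = ENNReal.ofReal δ}

/-- `Δ(ε)`: the supremum of the measures `δ` that are guaranteed for sets of measure `ε`. -/
noncomputable def symDelta (ε : ℝ) : ℝ :=
  sSup (guaranteedMeasures ε)

/-- For `0 ≤ ε ≤ 1` the supremum defining `Δ(ε)` is over a nonempty set bounded above. -/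
theorem guaranteedMeasures_nonempty_bddAbove (ε : ℝ) (h0 : 0 ≤ ε) (h1 : ε ≤ 1) :
    (guaranteedMeasures ε).Nonempty ∧ BddAbove (guaranteedMeasures ε) := by
  refine ⟨⟨0, le_rfl, fun A _ _ _ => ⟨∅, Set.empty_subset _, ⟨0, by simp⟩, by simp, by simp⟩⟩,
    ⟨ε, ?_⟩⟩
  rintro δ ⟨-, h⟩
  obtain ⟨C, hCA, -, -, hC⟩ := h (Set.Ico 0 ε) (Set.Ico_subset_Ico_right h1)
    measurableSet_Ico.nullMeasurableSet (by simp)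
  have := measure_mono (μ := volume) hCA
  rw [hC, Real.volume_Ico, sub_zero] at this
  exact (ENNReal.ofReal_le_ofReal_iff h0).1 this

/-! The largest symmetric subset of `A` centred at `s / 2` is `A ∩ (s - A)`, and its measure is the
autoconvolution of the indicator `χ` of `A` at `s`. Intersecting with intervals centred at `s / 2`
realises every smaller measure. So `Δ(ε)` measures how small the supremum of `χ * χ` can be made.

Lower bounds. Inclusion–exclusion for `A` and `1 - A` gives `2ε - 1`. For small `ε`, suppose `χ * χ
≤ D` and let `F` be the autocorrelation of `χ`. Then `∫ F² = ∫ (χ * χ)² ≤ D ε²`, and since `F` lives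
on `[-1, 1]` with integral `ε²`, Cauchy–Schwarz already yields `D ≥ ε² / 2`. The gain comes from the
smoothing `h` of `χ` by the indicator of `[0, d]`: small `D` makes the correlation of `h` with its
reflection small, while `h` plus its reflection has a large `L²` norm. Hence `∫ h² = ∫ F k` is
large, with `k` a tent at `0`, so `F` is far from constant and `∫ F²` exceeds its trivial bound. The
result, `D > 0.609 ε²` (`lt_of_lconv_indicator_le`), implies (ii), and with `2ε - 1` also (iii).

Upper bounds. A density with values in `[0, 1]` is as good as a set: on `N` cells, rounding to `0`
and `1` changes the total and each autoconvolution value by `o(N)`. This is the exponential moment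
method, derandomised because the expectations are affine in each coordinate
(`exists_rounding_pairs`). An eight-step density gives `96/121`, and `min(1, b/√x)` gives `π b²`.
Enlarging a set by measure `u` raises its autoconvolution by at most `2u`, which extends the
eight-step bound beyond `11/16` with slope exactly `2`. -/

open scoped ENNReal

/-! ### Convolution and autocorrelation identities. -/

/-- The autocorrelation `t ↦ ∫ χ(x) χ(x + t) dx`. -/
noncomputable def autocorr (χ : ℝ → ℝ≥0∞) (t : ℝ) : ℝ≥0∞ := ∫⁻ x, χ x * χ (x + t)

/-- The convolution `s ↦ ∫ f(x) g(s - x) dx`. -/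
noncomputable def lconv (f g : ℝ → ℝ≥0∞) (s : ℝ) : ℝ≥0∞ := ∫⁻ x, f x * g (s - x)

section Tonelli

variable {f g k : ℝ → ℝ≥0∞}

theorem measurable_lconv (hf : Measurable f) (hg : Measurable g) : Measurable (lconv f g) := by
  apply Measurable.lintegral_prod_right' (f := fun p : ℝ × ℝ => f p.2 * g (p.1 - p.2))
  fun_prop

theorem measurable_autocorr (hf : Measurable f) : Measurable (autocorr f) := by
  apply Measurable.lintegral_prod_right' (f := fun p : ℝ × ℝ => f p.2 * f (p.2 + p.1))
  fun_prop

theorem lintegral_lconv_mul (hf : Measurable f) (hg : Measurable g) (hk : Measurable k) :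
    ∫⁻ s, lconv f g s * k s = ∫⁻ x, ∫⁻ y, f x * g y * k (x + y) := by
  calc ∫⁻ s, lconv f g s * k s = ∫⁻ s, ∫⁻ x, f x * g (s - x) * k s := by
        refine lintegral_congr fun s => ?_
        rw [lconv, lintegral_mul_const _ (by fun_prop)]
    _ = ∫⁻ x, ∫⁻ s, f x * g (s - x) * k s := lintegral_lintegral_swap (by fun_prop)
    _ = _ := by
        refine lintegral_congr fun x => ?_
        rw [← lintegral_add_left_eq_self _ x]
        simp

theorem lintegral_autocorr_mul (hf : Measurable f) (hk : Measurable k) :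
    ∫⁻ t, autocorr f t * k t = ∫⁻ x, ∫⁻ y, f x * f y * k (y - x) := by
  calc ∫⁻ s, autocorr f s * k s = ∫⁻ s, ∫⁻ x, f x * f (x + s) * k s := by
        refine lintegral_congr fun s => ?_
        rw [autocorr, lintegral_mul_const _ (by fun_prop)]
    _ = ∫⁻ x, ∫⁻ s, f x * f (x + s) * k s := lintegral_lintegral_swap (by fun_prop)
    _ = _ := by
        refine lintegral_congr fun x => ?_
        rw [← lintegral_add_left_eq_self (fun y => f x * f y * k (y - x)) x]
        simp

theorem lintegral_lconv (hf : Measurable f) (hg : Measurable g) :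
    ∫⁻ s, lconv f g s = (∫⁻ x, f x) * ∫⁻ x, g x := by
  have := lintegral_lconv_mul hf hg (measurable_const (a := (1 : ℝ≥0∞)))
  simp only [mul_one] at this
  rw [this, ← lintegral_lintegral_mul hf.aemeasurable hg.aemeasurable]

theorem lintegral_autocorr (hf : Measurable f) :
    ∫⁻ s, autocorr f s = (∫⁻ x, f x) ^ 2 := by
  have := lintegral_autocorr_mul hf (measurable_const (a := (1 : ℝ≥0∞)))
  simp only [mul_one] at this
  rw [this, sq, ← lintegral_lintegral_mul hf.aemeasurable hf.aemeasurable]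

/-- The product of two integrals, integrated over a parameter. -/
theorem lintegral_mul_lintegral {u v : ℝ → ℝ → ℝ≥0∞} (hu : Measurable (Function.uncurry u))
    (hv : Measurable (Function.uncurry v)) :
    ∫⁻ t, (∫⁻ x, u t x) * ∫⁻ y, v t y = ∫⁻ x, ∫⁻ y, ∫⁻ t, u t x * v t y := by
  have hu' : Measurable fun p : ℝ × ℝ => u p.1 p.2 := hu
  have hv' : Measurable fun p : ℝ × ℝ => v p.1 p.2 := hv
  calc ∫⁻ t, (∫⁻ x, u t x) * ∫⁻ y, v t y = ∫⁻ t, ∫⁻ x, ∫⁻ y, u t x * v t y := by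
        refine lintegral_congr fun t => ?_
        exact (lintegral_lintegral_mul (hu'.comp measurable_prodMk_left).aemeasurable
          (hv'.comp measurable_prodMk_left).aemeasurable).symm
    _ = ∫⁻ x, ∫⁻ t, ∫⁻ y, u t x * v t y := by
        refine lintegral_lintegral_swap (Measurable.aemeasurable ?_)
        apply Measurable.lintegral_prod_right'
          (f := fun p : (ℝ × ℝ) × ℝ => u p.1.1 p.1.2 * v p.1.1 p.2)
        exact (hu'.comp measurable_fst).mul
          (hv'.comp ((measurable_fst.comp measurable_fst).prodMk measurable_snd))
    _ = _ := by
        refine lintegral_congr fun x => lintegral_lintegral_swap (Measurable.aemeasurable ?_)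
        exact (hu'.comp (measurable_fst.prodMk measurable_const)).mul hv'

/-- The autocorrelation and the autoconvolution have the same `L²` norm. -/
theorem lintegral_autocorr_sq (hf : Measurable f) :
    ∫⁻ t, autocorr f t * autocorr f t = ∫⁻ s, lconv f f s * lconv f f s := by
  simp only [autocorr, lconv]
  rw [lintegral_mul_lintegral (by unfold Function.uncurry; fun_prop)
      (by unfold Function.uncurry; fun_prop),
    lintegral_mul_lintegral (by unfold Function.uncurry; fun_prop)
      (by unfold Function.uncurry; fun_prop)]
  refine lintegral_congr fun x => lintegral_congr fun y => ?_
  rw [← lintegral_add_left_eq_self (fun t => f x * f (t - x) * (f y * f (t - y))) (x + y)]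
  refine lintegral_congr fun t => ?_
  rw [show x + y + t - x = y + t by ring, show x + y + t - y = x + t by ring]
  ring

/-- Both sides integrate `f(x) f(y) g(u) g(v)` over `x + u = y + v`, that is, over `y - x = u - v`.
-/
theorem lintegral_lconv_sq (hf : Measurable f) (hg : Measurable g) :
    ∫⁻ x, lconv f g x * lconv f g x = ∫⁻ t, autocorr f t * autocorr g t := by
  rw [lintegral_autocorr_mul hf (measurable_autocorr hg)]
  simp only [autocorr, lconv]
  rw [lintegral_mul_lintegral (by unfold Function.uncurry; fun_prop)
      (by unfold Function.uncurry; fun_prop)]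
  refine lintegral_congr fun x => lintegral_congr fun y => ?_
  rw [← lintegral_const_mul _ (by fun_prop),
    ← lintegral_add_left_eq_self (fun t => f x * g (t - x) * (f y * g (t - y))) y]
  refine lintegral_congr fun t => ?_
  rw [show y + t - x = t + (y - x) by ring, show y + t - y = t by ring]
  ring

/-- Both sides integrate `f(x) f(y) g(u) g(v)` over `x + y + u + v = w`, with the variables paired
differently. -/
theorem lintegral_lconv_mul_lconv_sub (hf : Measurable f) (hg : Measurable g) (w : ℝ) :
    ∫⁻ x, lconv f g x * lconv f g (w - x) = ∫⁻ s, lconv f f s * lconv g g (w - s) := by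
  have hm : Measurable fun s => lconv g g (w - s) :=
    (measurable_lconv hg hg).comp (by fun_prop : Measurable fun s : ℝ => w - s)
  rw [lintegral_lconv_mul hf hf hm]
  simp only [lconv]
  rw [lintegral_mul_lintegral (by unfold Function.uncurry; fun_prop)
      (by unfold Function.uncurry; fun_prop)]
  refine lintegral_congr fun x => lintegral_congr fun y => ?_
  rw [← lintegral_const_mul _ (by fun_prop),
    ← lintegral_add_left_eq_self (fun t => f x * g (t - x) * (f y * g (w - t - y))) x]
  refine lintegral_congr fun t => ?_
  rw [show x + t - x = t by ring, show w - (x + t) - y = w - (x + y) - t by ring]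
  ring

end Tonelli

/-! ### The second-moment bound for the autoconvolution of a set. -/

open scoped NNReal

theorem ENNReal.two_mul_mul_le_add (a b : ℝ≥0∞) : 2 * (a * b) ≤ a * a + b * b := by
  rcases le_total a b with h | h <;> obtain ⟨c, rfl⟩ := exists_add_of_le h
  · calc 2 * (a * (a + c)) ≤ 2 * (a * (a + c)) + c * c := le_self_add
      _ = _ := by ring
  · calc 2 * ((b + c) * b) ≤ 2 * ((b + c) * b) + c * c := le_self_add
      _ = _ := by ring

/-- Cauchy–Schwarz in additive form, so that no division or square root occurs in `ℝ≥0∞`. It loses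
nothing once `φ` is scaled optimally; the test function is only charged for its part on `S`. -/
theorem two_mul_lintegral_mul_le {f φ : ℝ → ℝ≥0∞} (hf : Measurable f)
    {S : Set ℝ} (hS : ∀ x ∉ S, f x = 0) :
    2 * ∫⁻ x, f x * φ x ≤ (∫⁻ x, f x * f x) + ∫⁻ x in S, φ x * φ x := by
  have h1 : ∫⁻ x, f x * φ x = ∫⁻ x in S, f x * φ x :=
    (setLIntegral_eq_of_support_subset (by
      intro x hx; by_contra h; simp [hS x h] at hx)).symm
  rw [h1, ← lintegral_const_mul' _ _ (by simp)]
  calc ∫⁻ x in S, 2 * (f x * φ x) ≤ ∫⁻ x in S, (f x * f x + φ x * φ x) :=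
        lintegral_mono fun x => ENNReal.two_mul_mul_le_add _ _
    _ = (∫⁻ x in S, f x * f x) + ∫⁻ x in S, φ x * φ x := lintegral_add_left (by fun_prop) _
    _ ≤ _ := by gcongr; exact Measure.restrict_le_self

theorem lconv_indicator_eq_zero {A B : Set ℝ} {a b c d x : ℝ} (hA : A ⊆ Set.Icc a b)
    (hB : B ⊆ Set.Icc c d) (hx : x ∉ Set.Icc (a + c) (b + d)) :
    lconv (A.indicator 1) (B.indicator 1) x = 0 := by
  refine (lintegral_congr (g := fun _ => 0) fun y => ?_).trans lintegral_zero
  by_cases h1 : y ∈ A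
  · by_cases h2 : x - y ∈ B
    · have := hA h1
      have := hB h2
      simp only [Set.mem_Icc] at *
      exact absurd ⟨by linarith, by linarith⟩ hx
    · simp [h2]
  · simp [h1]

theorem autocorr_indicator_eq_zero {A : Set ℝ} {a b t : ℝ} (hA : A ⊆ Set.Icc a b)
    (ht : t ∉ Set.Icc (-(b - a)) (b - a)) : autocorr (A.indicator 1) t = 0 := by
  refine (lintegral_congr (g := fun _ => 0) fun y => ?_).trans lintegral_zero
  by_cases h1 : y ∈ A
  · by_cases h2 : y + t ∈ A
    · have := hA h1
      have := hA h2
      simp only [Set.mem_Icc] at *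
      exact absurd ⟨by linarith, by linarith⟩ ht
    · simp [h2]
  · simp [h1]

theorem autocorr_indicator_Icc (d t : ℝ) :
    autocorr ((Set.Icc 0 d).indicator 1) t = ENNReal.ofReal (d - |t|) := by
  have : ∀ x, (Set.Icc 0 d).indicator (1 : ℝ → ℝ≥0∞) x * (Set.Icc 0 d).indicator 1 (x + t)
      = (Set.Icc (max 0 (-t)) (min d (d - t))).indicator 1 x := by
    intro x
    have e : x ∈ Set.Icc (max 0 (-t)) (min d (d - t)) ↔
        x ∈ Set.Icc 0 d ∧ x + t ∈ Set.Icc 0 d := by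
      simp only [Set.mem_Icc, max_le_iff, le_min_iff]
      constructor
      · rintro ⟨⟨a, b⟩, c, e⟩; refine ⟨⟨a, c⟩, ?_, ?_⟩ <;> linarith
      · rintro ⟨⟨a, b⟩, c, e⟩; refine ⟨⟨a, ?_⟩, b, ?_⟩ <;> linarith
    by_cases h1 : x ∈ Set.Icc 0 d <;> by_cases h2 : x + t ∈ Set.Icc 0 d <;>
      simp only [Set.indicator, e, h1, h2] <;> simp
  rw [autocorr, lintegral_congr this, lintegral_indicator_one measurableSet_Icc, Real.volume_Icc]
  congr 1
  rcases le_total 0 t with h | h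
  · rw [max_eq_left (by linarith), min_eq_right (by linarith), abs_of_nonneg h, sub_zero]
  · rw [max_eq_right (by linarith), min_eq_left (by linarith), abs_of_nonpos h]

theorem lintegral_autocorr_indicator_Icc_sq {d : ℝ} (hd : 0 ≤ d) :
    ∫⁻ t, autocorr ((Set.Icc 0 d).indicator 1) t * autocorr ((Set.Icc 0 d).indicator 1) t =
      ENNReal.ofReal (2 / 3 * d ^ 3) := by
  have h1 : ∀ t, autocorr ((Set.Icc 0 d).indicator 1) t * autocorr ((Set.Icc 0 d).indicator 1) t =
      (Set.Ioc (-d) d).indicator (fun t => ENNReal.ofReal ((d - |t|) ^ 2)) t := by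
    intro t
    rw [autocorr_indicator_Icc]
    by_cases ht : t ∈ Set.Ioc (-d) d
    · have : |t| ≤ d := abs_le.2 ⟨ht.1.le, ht.2⟩
      rw [Set.indicator_of_mem ht, ← ENNReal.ofReal_mul (by linarith), sq]
    · have : d ≤ |t| := by
        by_contra h
        rw [not_le, abs_lt] at h
        exact ht ⟨h.1, h.2.le⟩
      rw [Set.indicator_of_notMem ht, ENNReal.ofReal_of_nonpos (by linarith), zero_mul]
  have hc : Continuous fun t : ℝ => (d - |t|) ^ 2 := by fun_prop
  rw [lintegral_congr h1, lintegral_indicator measurableSet_Ioc,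
    ← ofReal_integral_eq_lintegral_ofReal
      ((intervalIntegrable_iff_integrableOn_Ioc_of_le (by linarith)).1 (hc.intervalIntegrable _ _))
      (Filter.Eventually.of_forall fun t => sq_nonneg _),
    ← intervalIntegral.integral_of_le (by linarith),
    ← intervalIntegral.integral_add_adjacent_intervals (hc.intervalIntegrable (-d) 0)
      (hc.intervalIntegrable 0 d)]
  congr 1
  have e1 : ∫ t in (-d)..0, (d - |t|) ^ 2 = ∫ t in (-d)..0, (d + t) ^ 2 := by
    refine intervalIntegral.integral_congr fun t ht => ?_
    rw [Set.uIcc_of_le (by linarith)] at ht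
    simp only [abs_of_nonpos ht.2]; ring
  have e2 : ∫ t in (0)..d, (d - |t|) ^ 2 = ∫ t in (0)..d, (d - t) ^ 2 := by
    refine intervalIntegral.integral_congr fun t ht => ?_
    rw [Set.uIcc_of_le hd] at ht
    simp only [abs_of_nonneg ht.1]
  rw [e1, e2, intervalIntegral.integral_comp_add_left (fun x => x ^ 2),
    intervalIntegral.integral_comp_sub_left (fun x => x ^ 2)]
  simp only [integral_pow]
  norm_num
  ring

/-- If the autoconvolution of a set of measure `e` in `[0, 1]` is at most `D`, then
`0.609 e² < D`. -/
theorem lt_of_lconv_indicator_le {A : Set ℝ} (hA : MeasurableSet A) (hA01 : A ⊆ Set.Icc 0 1)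
    {e D : ℝ≥0} (he : 0 < e) (hvol : volume A = e)
    (hD : ∀ s, lconv (A.indicator 1) (A.indicator 1) s ≤ D) : 0.609 * e ^ 2 < D := by
  -- The smoothing length `d`, like `β = 4 e²` below, is tuned numerically for the final constant.
  obtain ⟨d, hd⟩ : ∃ d : ℝ≥0, d = 0.23 := ⟨_, rfl⟩
  have hd' : (d : ℝ) = 0.23 := by rw [hd]; norm_num
  set χ : ℝ → ℝ≥0∞ := A.indicator 1 with hχ
  set I : ℝ → ℝ≥0∞ := (Set.Icc 0 (d : ℝ)).indicator 1 with hI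
  have mχ : Measurable χ := measurable_one.indicator hA
  have mI : Measurable I := measurable_one.indicator measurableSet_Icc
  have iχ : ∫⁻ x, χ x = e := by rw [hχ, lintegral_indicator_one hA, hvol]
  have iI : ∫⁻ x, I x = d := by
    rw [hI, lintegral_indicator_one measurableSet_Icc, Real.volume_Icc, sub_zero,
      ENNReal.ofReal_coe_nnreal]
  have mh := measurable_lconv mχ mI
  have mF := measurable_autocorr mχ
  have mk := measurable_autocorr mI
  set h := lconv χ I with hh
  set F := autocorr χ with hF
  set k := autocorr I with hk
  have ih : ∫⁻ x, h x = e * d := by rw [hh, lintegral_lconv mχ mI, iχ, iI]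
  have ik : ∫⁻ x, k x = d ^ 2 := by rw [hk, lintegral_autocorr mI, iI]
  have iF : ∫⁻ x, F x = e ^ 2 := by rw [hF, lintegral_autocorr mχ, iχ]
  have iH : ∫⁻ x, lconv χ χ x = e * e := by rw [lintegral_lconv mχ mχ, iχ]
  have ikk : ∫⁻ t, k t * k t = ((2 / 3 * d ^ 3 : ℝ≥0) : ℝ≥0∞) := by
    rw [hk, hI, lintegral_autocorr_indicator_Icc_sq d.coe_nonneg, ← ENNReal.ofReal_coe_nnreal]
    congr 1
  have ihr : ∫⁻ x, h (1 + d - x) = e * d := by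
    rw [lintegral_sub_left_eq_self (fun x => h x), ih]
  have mhr : Measurable fun x => h (1 + d - x) :=
    mh.comp (by fun_prop : Measurable fun s : ℝ => 1 + (d : ℝ) - s)
  have J2le : ∫⁻ x, h x * h (1 + d - x) ≤ D * d ^ 2 := by
    rw [hh, lintegral_lconv_mul_lconv_sub mχ mI]
    calc ∫⁻ s, lconv χ χ s * lconv I I (1 + d - s) ≤ ∫⁻ s, D * lconv I I (1 + d - s) :=
          lintegral_mono fun s => by gcongr; exact hD s
      _ = D * d ^ 2 := by
          rw [lintegral_const_mul' _ _ (by simp),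
            lintegral_sub_left_eq_self (fun s => lconv I I s), lintegral_lconv mI mI, iI, sq]
  have J3le : ∫⁻ t, F t * F t ≤ D * e ^ 2 := by
    rw [hF, lintegral_autocorr_sq mχ]
    calc ∫⁻ s, lconv χ χ s * lconv χ χ s ≤ ∫⁻ s, D * lconv χ χ s :=
          lintegral_mono fun s => by gcongr; exact hD s
      _ = D * e ^ 2 := by rw [lintegral_const_mul' _ _ (by simp), iH, sq]
  have J1eq : ∫⁻ x, h x * h x = ∫⁻ t, F t * k t := lintegral_lconv_sq mχ mI
  -- the even part of `h` against a constant
  obtain ⟨κ, hκ⟩ : ∃ κ : ℝ≥0, κ = 2 * d * e / (1 + d) := ⟨_, rfl⟩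
  -- `κ` is the mean of `h(x) + h(1 + d - x)` over `[0, 1 + d]`, which makes the additive inequality
  -- as strong as Cauchy–Schwarz.
  have R1 : 2 * ((e * d + e * d) * κ) ≤
      (∫⁻ t, F t * k t) + (∫⁻ x, h x * h (1 + d - x)) + (∫⁻ x, h x * h (1 + d - x)) +
        (∫⁻ t, F t * k t) + κ * κ * (1 + d : ℝ≥0) := by
    have key := two_mul_lintegral_mul_le (f := fun x => h x + h (1 + d - x))
      (φ := fun _ => κ) (mh.add mhr) (S := Set.Icc 0 (1 + d)) (by
        intro x hx
        have h0 : ∀ y ∉ Set.Icc 0 (1 + (d : ℝ)), h y = 0 := fun y hy =>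
          lconv_indicator_eq_zero hA01 subset_rfl (by simpa using hy)
        rw [h0 x hx, h0 (1 + d - x) (fun hy => hx ⟨by linarith [hy.2], by linarith [hy.1]⟩),
          add_zero])
    have e1 : ∫⁻ x, (h x + h (1 + d - x)) * κ = (e * d + e * d) * κ := by
      rw [lintegral_mul_const' _ _ (by simp), lintegral_add_left mh, ih, ihr]
    have e2 : ∫⁻ x, (h x + h (1 + d - x)) * (h x + h (1 + d - x)) =
        (∫⁻ t, F t * k t) + (∫⁻ x, h x * h (1 + d - x)) + (∫⁻ x, h x * h (1 + d - x)) +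
        (∫⁻ t, F t * k t) := by
      have e3 : ∫⁻ x, h (1 + d - x) * h (1 + d - x) = ∫⁻ t, F t * k t := by
        rw [lintegral_sub_left_eq_self (fun x => h x * h x), J1eq]
      rw [← e3]
      nth_rw 1 [e3]
      rw [← J1eq, ← lintegral_add_left (by fun_prop), ← lintegral_add_left (by fun_prop),
        ← lintegral_add_left (by fun_prop)]
      refine lintegral_congr fun x => ?_
      ring
    have e4 : ∫⁻ x in Set.Icc 0 (1 + (d : ℝ)), (κ : ℝ≥0∞) * κ = κ * κ * (1 + d : ℝ≥0) := by
      rw [setLIntegral_const, Real.volume_Icc, sub_zero, ← ENNReal.ofReal_coe_nnreal (p := 1 + d)]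
      simp
    rw [e1, e2, e4] at key
    exact key
  -- the autocorrelation against an affine function of `k`
  obtain ⟨α, hα⟩ : ∃ α : ℝ≥0, α = 0.3942 * e ^ 2 := ⟨_, rfl⟩
  -- Here `α = (e² - β d²) / 2`: then `β k + α` and `F` have the same integral over `[-1, 1]`, which
  -- is the best `α` for this `β`.
  obtain ⟨β, hβ⟩ : ∃ β : ℝ≥0, β = 4 * e ^ 2 := ⟨_, rfl⟩
  have R2 : 2 * (β * (∫⁻ t, F t * k t) + α * e ^ 2) ≤ (∫⁻ t, F t * F t) +
      (β * β * (2 / 3 * d ^ 3 : ℝ≥0) + 2 * α * β * d ^ 2 + α * α * 2) := by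
    have key := two_mul_lintegral_mul_le (f := F) (φ := fun t => β * k t + α) mF
      (S := Set.Icc (-(1 - 0)) (1 - 0)) (fun t ht => autocorr_indicator_eq_zero hA01 ht)
    have e1 : ∫⁻ t, F t * (β * k t + α) = β * (∫⁻ t, F t * k t) + α * e ^ 2 := by
      rw [← iF, ← lintegral_const_mul' _ _ (by simp), ← lintegral_const_mul' _ _ (by simp),
        ← lintegral_add_right _ (by fun_prop)]
      refine lintegral_congr fun t => ?_
      ring
    have e2 : ∫⁻ t in Set.Icc (-(1 - 0) : ℝ) (1 - 0), (β * k t + α) * (β * k t + α) ≤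
        β * β * (2 / 3 * d ^ 3 : ℝ≥0) + 2 * α * β * d ^ 2 + α * α * 2 := by
      have e3 : ∀ t, (β * k t + α) * (β * k t + α) =
          (β * β * (k t * k t) + 2 * α * β * k t) + (α : ℝ≥0∞) * α := fun t => by ring
      rw [lintegral_congr e3, lintegral_add_right _ measurable_const,
        lintegral_add_right _ (by fun_prop), setLIntegral_const, Real.volume_Icc]
      norm_num only
      rw [ENNReal.ofReal_ofNat]
      gcongr
      · rw [← ikk, ← lintegral_const_mul' _ _ (ENNReal.mul_ne_top (by simp) (by simp))]
        exact lintegral_mono' Measure.restrict_le_self le_rfl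
      · rw [← ik, ← lintegral_const_mul' _ _
          (ENNReal.mul_ne_top (ENNReal.mul_ne_top (by simp) (by simp)) (by simp))]
        exact lintegral_mono' Measure.restrict_le_self le_rfl
    rw [e1] at key
    exact key.trans (by gcongr)
  have t2 : ∫⁻ x, h x * h (1 + d - x) ≠ ∞ :=
    ne_top_of_le_ne_top (ENNReal.mul_ne_top (by simp) (by simp)) J2le
  have t3 : ∫⁻ t, F t * F t ≠ ∞ :=
    ne_top_of_le_ne_top (ENNReal.mul_ne_top (by simp) (by simp)) J3le
  -- Finiteness comes from `R2` itself: its right side is finite and `β` is positive.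
  have t1 : ∫⁻ t, F t * k t ≠ ∞ := by
    intro ht
    rw [ht, ENNReal.mul_top (by simp [hβ, he.ne']), top_add, ENNReal.mul_top (by simp)] at R2
    refine absurd R2 (not_le.2 (ENNReal.add_lt_top.2 ⟨t3.lt_top, ?_⟩))
    exact_mod_cast ENNReal.coe_lt_top
  generalize (∫⁻ t, F t * k t) = J1 at *
  generalize (∫⁻ t, F t * F t) = J3 at *
  generalize (∫⁻ x, h x * h (1 + d - x)) = J2 at *
  lift J1 to ℝ≥0 using t1
  lift J2 to ℝ≥0 using t2
  lift J3 to ℝ≥0 using t3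
  have r1 : 2 * ((e * d + e * d) * κ) ≤ J1 + J2 + J2 + J1 + κ * κ * (1 + d) := by exact_mod_cast R1
  have r2 : 2 * (β * J1 + α * e ^ 2) ≤
      J3 + (β * β * (2 / 3 * d ^ 3) + 2 * α * β * d ^ 2 + α * α * 2) := by exact_mod_cast R2
  have r3 : J2 ≤ D * d ^ 2 := by exact_mod_cast J2le
  have r4 : J3 ≤ D * e ^ 2 := by exact_mod_cast J3le
  rw [← NNReal.coe_lt_coe]
  rw [← NNReal.coe_le_coe] at r1 r2 r3 r4
  have he' : (0 : ℝ) < e := he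
  have hκ' : (κ : ℝ) = 2 * 0.23 * e / 1.23 := by rw [hκ]; push_cast; rw [hd']; norm_num
  have hα' : (α : ℝ) = 0.3942 * e ^ 2 := by rw [hα]; push_cast; norm_num
  have hβ' : (β : ℝ) = 4 * e ^ 2 := by rw [hβ]; push_cast; norm_num
  push_cast [hd', hκ', hα', hβ'] at r1 r2 r3 r4 ⊢
  -- Eliminating `J1` between `q1` and `q3` leaves a lower bound of about `0.6107 e²` for `D`.
  have q1 : 2 * 0.23 ^ 2 * (e : ℝ) ^ 2 / 1.23 ≤ J1 + D * 0.23 ^ 2 := by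
    norm_num at r1 r3 ⊢
    nlinarith
  have q2 : (e : ℝ) ^ 2 * (8 * J1 + 0.7884 * e ^ 2) ≤
      e ^ 2 * (D + e ^ 2 * (16 * (2 / 3 * 0.23 ^ 3) + 8 * 0.3942 * 0.23 ^ 2 +
        2 * 0.3942 ^ 2)) := by nlinarith
  have q3 := le_of_mul_le_mul_left q2 (pow_pos he' 2)
  have : 0 < (e : ℝ) ^ 2 := by positivity
  norm_num at q1 q3 ⊢
  linarith

/-! ### From autoconvolutions to lower bounds for `Δ`. -/

open Set (Icc Ico)

/-- The mass of `B` within distance `r` of `c` is continuous in `r`, vanishes at `0` and is all of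
`B` at `|c| + 1`; the intermediate value theorem applies. -/
theorem exists_volume_inter_Icc_eq {B : Set ℝ} (hB : MeasurableSet B) (hB01 : B ⊆ Ico 0 1)
    (c : ℝ) {δ : ℝ} (h0 : 0 ≤ δ) (hδ : ENNReal.ofReal δ ≤ volume B) :
    ∃ r : ℝ, volume (B ∩ Icc (c - r) (c + r)) = ENNReal.ofReal δ := by
  have hfin : volume B ≠ ∞ := ne_top_of_le_ne_top (by simp) (measure_mono hB01)
  have hint : Integrable (B.indicator (fun _ => (1 : ℝ))) volume :=
    (integrable_indicator_iff hB).2 (integrableOn_const hfin)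
  set P : ℝ → ℝ := fun r => ∫ x in (c - r)..(c + r), B.indicator (fun _ => (1 : ℝ)) x with hP
  have hcont : Continuous P := by
    have h1 : Continuous fun b => ∫ x in (0)..b, B.indicator (fun _ => (1 : ℝ)) x :=
      intervalIntegral.continuous_primitive (fun a b => hint.intervalIntegrable) 0
    have h2 : P = fun r => (∫ x in (0)..(c + r), B.indicator (fun _ => (1 : ℝ)) x) -
        ∫ x in (0)..(c - r), B.indicator (fun _ => (1 : ℝ)) x := by
      ext r
      rw [hP, intervalIntegral.integral_interval_sub_left hint.intervalIntegrable
        hint.intervalIntegrable]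
    rw [h2]
    exact (h1.comp (by fun_prop)).sub (h1.comp (by fun_prop))
  have hPv : ∀ r, 0 ≤ r → volume (B ∩ Icc (c - r) (c + r)) = ENNReal.ofReal (P r) := by
    intro r hr
    have hne : volume (B ∩ Icc (c - r) (c + r)) ≠ ∞ :=
      ne_top_of_le_ne_top hfin (measure_mono Set.inter_subset_left)
    rw [hP]
    simp only
    rw [intervalIntegral.integral_of_le (by linarith), ← integral_Icc_eq_integral_Ioc,
      setIntegral_indicator hB, setIntegral_const, smul_eq_mul, mul_one, Set.inter_comm,
      measureReal_def, ENNReal.ofReal_toReal (by rwa [Set.inter_comm])]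
  have hbig : B ∩ Icc (c - (|c| + 1)) (c + (|c| + 1)) = B := by
    refine Set.inter_eq_left.2 fun x hx => ?_
    have := hB01 hx
    have h1 := le_abs_self c
    have h2 := neg_abs_le c
    exact ⟨by linarith [this.1], by linarith [this.2]⟩
  have hR : 0 ≤ |c| + 1 := by positivity
  have hPR := hPv _ hR
  rw [hbig] at hPR
  rw [hPR] at hδ
  have hPδ : δ ≤ P (|c| + 1) := by
    have hp : 0 ≤ P (|c| + 1) :=
      intervalIntegral.integral_nonneg (by linarith)
        fun x _ => Set.indicator_nonneg (fun _ _ => zero_le_one) x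
    exact (ENNReal.ofReal_le_ofReal_iff hp).1 hδ
  obtain ⟨r, hr, hrδ⟩ := intermediate_value_Icc hR hcont.continuousOn
    (show δ ∈ Icc (P 0) (P (|c| + 1)) from ⟨by simpa [hP] using h0, hPδ⟩)
  exact ⟨r, by rw [hPv r hr.1, hrδ]⟩

/-- Reduces the problem to Borel sets and to a lower bound for one value of the autoconvolution: a
null-measurable `A` contains a measurable subset of full measure, and trimming by intervals centred
at `s / 2` keeps the symmetry. -/
theorem mem_guaranteedMeasures {ε δ : ℝ} (hδ : 0 ≤ δ)
    (h : ∀ A : Set ℝ, A ⊆ Ico 0 1 → MeasurableSet A → volume A = ENNReal.ofReal ε →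
      ∃ s : ℝ, ENNReal.ofReal δ ≤ volume (A ∩ (fun x => s - x) ⁻¹' A)) :
    δ ∈ guaranteedMeasures ε := by
  refine ⟨hδ, fun A hA hAm hAv => ?_⟩
  obtain ⟨B, hBA, hBm, hBv⟩ := hAm.exists_measurable_subset_ae_eq
  obtain ⟨s, hs⟩ := h B (hBA.trans hA) hBm ((measure_congr hBv).trans hAv)
  have hm : MeasurableSet (B ∩ (fun x => s - x) ⁻¹' B) :=
    hBm.inter ((by fun_prop : Measurable fun x : ℝ => s - x) hBm)
  obtain ⟨r, hr⟩ := exists_volume_inter_Icc_eq hm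
    (Set.inter_subset_left.trans (hBA.trans hA)) (s / 2) hδ hs
  refine ⟨_, (Set.inter_subset_left.trans Set.inter_subset_left).trans hBA, ⟨s / 2, fun x => ?_⟩,
    (hm.inter measurableSet_Icc).nullMeasurableSet, hr⟩
  simp only [Set.mem_inter_iff, Set.mem_preimage, Set.mem_Icc,
    show s - (s / 2 + x) = s / 2 - x by ring, show s - (s / 2 - x) = s / 2 + x by ring]
  constructor
  · rintro ⟨⟨a, b⟩, c, d⟩
    exact ⟨⟨b, a⟩, by linarith, by linarith⟩
  · rintro ⟨⟨a, b⟩, c, d⟩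
    exact ⟨⟨b, a⟩, by linarith, by linarith⟩

theorem le_symDelta {ε δ : ℝ} (h0 : 0 ≤ ε) (h1 : ε ≤ 1) (h : δ ∈ guaranteedMeasures ε) :
    δ ≤ symDelta ε :=
  le_csSup (guaranteedMeasures_nonempty_bddAbove ε h0 h1).2 h

theorem lconv_indicator_self {A : Set ℝ} (hA : MeasurableSet A) (s : ℝ) :
    lconv (A.indicator 1) (A.indicator 1) s = volume (A ∩ (fun x => s - x) ⁻¹' A) := by
  have hm : MeasurableSet (A ∩ (fun x => s - x) ⁻¹' A) :=
    hA.inter ((by fun_prop : Measurable fun x : ℝ => s - x) hA)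
  rw [← lintegral_indicator_one hm, lconv]
  refine lintegral_congr fun x => ?_
  by_cases h1 : x ∈ A <;> by_cases h2 : s - x ∈ A <;> simp [Set.indicator, h1, h2]

/-- Quadratic lower bound. -/
theorem mul_sq_le_symDelta {ε : ℝ} (h0 : 0 < ε) (h1 : ε ≤ 1) : 0.609 * ε ^ 2 ≤ symDelta ε := by
  refine le_symDelta h0.le h1 (mem_guaranteedMeasures (by positivity) fun A hA hAm hAv => ?_)
  by_contra! hcon
  have := lt_of_lconv_indicator_le (e := ε.toNNReal) (D := (0.609 * ε ^ 2).toNNReal) hAm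
    (hA.trans Set.Ico_subset_Icc_self) (Real.toNNReal_pos.2 h0) hAv
    (fun s => by rw [lconv_indicator_self hAm]; exact (hcon s).le)
  rw [← NNReal.coe_lt_coe, Real.coe_toNNReal _ (by positivity)] at this
  push_cast [Real.coe_toNNReal _ h0.le] at this
  exact lt_irrefl _ this

/-- Linear lower bound, from the reflection about `1 / 2`. -/
theorem two_mul_sub_one_le_symDelta {ε : ℝ} (h0 : 1 / 2 ≤ ε) (h1 : ε ≤ 1) :
    2 * ε - 1 ≤ symDelta ε := by
  refine le_symDelta (by linarith) h1
    (mem_guaranteedMeasures (by linarith) fun A hA hAm hAv => ⟨1, ?_⟩)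
  have hB : MeasurableSet ((fun x : ℝ => 1 - x) ⁻¹' A) :=
    (by fun_prop : Measurable fun x : ℝ => 1 - x) hAm
  have hBv : volume ((fun x : ℝ => 1 - x) ⁻¹' A) = ENNReal.ofReal ε := by
    rw [(Measure.measurePreserving_sub_left volume (1 : ℝ)).measure_preimage hAm.nullMeasurableSet, hAv]
  have hu : volume (A ∪ (fun x : ℝ => 1 - x) ⁻¹' A) ≤ 1 := by
    calc volume (A ∪ (fun x : ℝ => 1 - x) ⁻¹' A) ≤ volume (Icc (0 : ℝ) 1) := by
          refine measure_mono (Set.union_subset (hA.trans Set.Ico_subset_Icc_self) fun x hx => ?_)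
          have := hA hx
          exact ⟨by linarith [this.2], by linarith [this.1]⟩
      _ = 1 := by simp
  have key := measure_union_add_inter (μ := volume) A hB
  rw [hAv, hBv, ← ENNReal.ofReal_add (by linarith) (by linarith)] at key
  rw [show 2 * ε - 1 = ε + ε - 1 by ring, ENNReal.ofReal_sub _ zero_le_one, ← key,
    ENNReal.ofReal_one, tsub_le_iff_left]
  gcongr

/-! ### From sets with small autoconvolution to upper bounds for `Δ`. -/

/-- A family of subsets of `[0, 1)` with measure at least `a - η` whose autoconvolutions are
at most `M + η`, for all `η > 0`. -/
def HasThinSets (a M : ℝ) : Prop :=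
  ∀ η : ℝ, 0 < η → ∃ A : Set ℝ, A ⊆ Ico 0 1 ∧ MeasurableSet A ∧ ENNReal.ofReal (a - η) ≤ volume A ∧
    ∀ s : ℝ, volume (A ∩ (fun x => s - x) ⁻¹' A) ≤ ENNReal.ofReal (M + η)

theorem volume_union_inter_reflect_le {A B : Set ℝ} (hB : MeasurableSet B) (s : ℝ) :
    volume ((A ∪ B) ∩ (fun x => s - x) ⁻¹' (A ∪ B)) ≤
      volume (A ∩ (fun x => s - x) ⁻¹' A) + (volume B + volume B) := by
  calc volume ((A ∪ B) ∩ (fun x => s - x) ⁻¹' (A ∪ B))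
      ≤ volume ((A ∩ (fun x => s - x) ⁻¹' A) ∪ (B ∪ (fun x => s - x) ⁻¹' B)) := by
        refine measure_mono ?_
        rintro x ⟨hx1, hx2⟩
        simp only [Set.mem_union, Set.mem_preimage, Set.mem_inter_iff] at *
        tauto
    _ ≤ _ := (measure_union_le _ _).trans (by
        gcongr
        refine (measure_union_le _ _).trans_eq ?_
        rw [(Measure.measurePreserving_sub_left volume s).measure_preimage hB.nullMeasurableSet])

theorem le_of_mem_guaranteedMeasures {ε δ M : ℝ} (hδ : δ ∈ guaranteedMeasures ε) (hM : 0 ≤ M)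
    {A : Set ℝ} (hA : A ⊆ Ico 0 1) (hAm : MeasurableSet A) (hv : volume A = ENNReal.ofReal ε)
    (h : ∀ s : ℝ, volume (A ∩ (fun x => s - x) ⁻¹' A) ≤ ENNReal.ofReal M) : δ ≤ M := by
  obtain ⟨C, hCA, ⟨c, hc⟩, -, hCv⟩ := hδ.2 A hA hAm.nullMeasurableSet hv
  refine (ENNReal.ofReal_le_ofReal_iff hM).1 ?_
  rw [← hCv]
  refine (measure_mono fun x hx => ?_).trans (h (2 * c))
  refine ⟨hCA hx, hCA ?_⟩
  have := (hc (x - c)).1 (by simpa using hx)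
  rwa [show c - (x - c) = 2 * c - x by ring] at this

/-- A set that is too large is cut down, which cannot raise the autoconvolution. One that is too
small is padded from its complement, at a cost of at most twice the added measure. -/
theorem HasThinSets.symDelta_le {a M ε : ℝ} (h : HasThinSets a M) (hM : 0 ≤ M) (h0 : 0 ≤ ε)
    (ha : a ≤ ε) (h1 : ε ≤ 1) : symDelta ε ≤ M + 2 * (ε - a) := by
  refine csSup_le (guaranteedMeasures_nonempty_bddAbove ε h0 h1).1 fun δ hδ => ?_
  refine le_of_forall_pos_le_add fun η' hη' => ?_
  -- One `η` is lost in the autoconvolution, two in the padding, whose measure can reach `ε - a +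
  -- η`.
  obtain ⟨η, rfl⟩ : ∃ η, η' = 3 * η := ⟨η' / 3, by ring⟩
  have hη : 0 < η := by linarith
  obtain ⟨A, hA, hAm, hAv, hAs⟩ := h η hη
  rcases le_total (ENNReal.ofReal ε) (volume A) with hle | hle
  · obtain ⟨r, hr⟩ := exists_volume_inter_Icc_eq hAm hA 0 h0 hle
    have := le_of_mem_guaranteedMeasures hδ (M := M + η) (by linarith)
      (Set.inter_subset_left.trans hA) (hAm.inter measurableSet_Icc) hr fun s =>
        (measure_mono (Set.inter_subset_inter Set.inter_subset_left
          (Set.preimage_mono Set.inter_subset_left))).trans (hAs s)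
    linarith
  · have hfin : volume A ≠ ∞ := ne_top_of_le_ne_top (by simp) hle
    obtain ⟨v, hv0, hv⟩ : ∃ v : ℝ, 0 ≤ v ∧ volume A = ENNReal.ofReal v :=
      ⟨_, ENNReal.toReal_nonneg, (ENNReal.ofReal_toReal hfin).symm⟩
    rw [hv] at hle hAv
    have hvε : v ≤ ε := (ENNReal.ofReal_le_ofReal_iff h0).1 hle
    have hav : a - η ≤ v := (ENNReal.ofReal_le_ofReal_iff hv0).1 hAv
    have hBm : MeasurableSet (Ico (0 : ℝ) 1 \ A) := measurableSet_Ico.diff hAm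
    have hBv : ENNReal.ofReal (ε - v) ≤ volume (Ico (0 : ℝ) 1 \ A) := by
      rw [measure_sdiff hA hAm.nullMeasurableSet hfin, hv, Real.volume_Ico,
        ← ENNReal.ofReal_sub _ hv0]
      exact ENNReal.ofReal_le_ofReal (by linarith)
    obtain ⟨r, hr⟩ := exists_volume_inter_Icc_eq hBm Set.sdiff_subset 0 (by linarith) hBv
    set B := Ico (0 : ℝ) 1 \ A ∩ Icc (0 - r) (0 + r) with hB
    have hBm' : MeasurableSet B := hBm.inter measurableSet_Icc
    have := le_of_mem_guaranteedMeasures hδ (M := M + η + (ε - v + (ε - v))) (by linarith)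
      (Set.union_subset hA (Set.inter_subset_left.trans Set.sdiff_subset)) (hAm.union hBm')
      (by
        rw [measure_union (Set.disjoint_left.2 fun x hx hx' => hx'.1.2 hx) hBm', hv, hr,
          ← ENNReal.ofReal_add hv0 (by linarith)]
        congr 1; ring)
      (fun s => (volume_union_inter_reflect_le hBm' s).trans (by
        rw [hr, ENNReal.ofReal_add (by linarith) (by linarith),
          ENNReal.ofReal_add (p := ε - v) (by linarith) (by linarith)]
        gcongr
        exact hAs s))
    linarith

/-! ### Rounding densities to `0` and `1`. -/

open Finset (range)

/-- A function of a sequence that is affine in each coordinate separately. -/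
def CoordAffine (G : (ℕ → ℝ) → ℝ) : Prop :=
  ∀ (x : ℕ → ℝ) (i : ℕ), ∃ a b : ℝ, ∀ y, G (Function.update x i y) = a + b * y

namespace CoordAffine

theorem const_mul {G : (ℕ → ℝ) → ℝ} (h : CoordAffine G) (c : ℝ) :
    CoordAffine fun x => c * G x := by
  intro x i
  obtain ⟨a, b, hab⟩ := h x i
  exact ⟨c * a, c * b, fun y => by simp only [hab]; ring⟩

theorem add {G H : (ℕ → ℝ) → ℝ} (hG : CoordAffine G) (hH : CoordAffine H) :
    CoordAffine fun x => G x + H x := by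
  intro x i
  obtain ⟨a, b, hab⟩ := hG x i
  obtain ⟨a', b', hab'⟩ := hH x i
  exact ⟨a + a', b + b', fun y => by simp only [hab, hab']; ring⟩

theorem sum {ι : Type*} {G : ι → (ℕ → ℝ) → ℝ} (s : Finset ι) (h : ∀ k ∈ s, CoordAffine (G k)) :
    CoordAffine fun x => ∑ k ∈ s, G k x := by
  classical
  induction s using Finset.induction_on with
  | empty => exact fun x i => ⟨0, 0, by simp⟩
  | insert k s hk ih =>
    simp only [Finset.sum_insert hk]
    exact (h k (by simp)).add (ih fun j hj => h j (by simp [hj]))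

/-- A product is affine in each coordinate if its factors are and if each coordinate occurs in
one factor only. -/
theorem prod {ι : Type*} {g : ι → (ℕ → ℝ) → ℝ} (s : Finset ι) (V : ι → Set ℕ)
    (hg : ∀ j ∈ s, CoordAffine (g j))
    (hdep : ∀ j ∈ s, ∀ x i y, i ∉ V j → g j (Function.update x i y) = g j x)
    (hdisj : ∀ j ∈ s, ∀ j' ∈ s, ∀ i, i ∈ V j → i ∈ V j' → j = j') :
    CoordAffine fun x => ∏ j ∈ s, g j x := by
  classical
  intro x i
  by_cases h : ∃ j ∈ s, i ∈ V j
  · obtain ⟨j, hj, hij⟩ := h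
    obtain ⟨a, b, hab⟩ := hg j hj x i
    refine ⟨a * ∏ k ∈ s.erase j, g k x, b * ∏ k ∈ s.erase j, g k x, fun y => ?_⟩
    have : ∏ k ∈ s.erase j, g k (Function.update x i y) = ∏ k ∈ s.erase j, g k x := by
      refine Finset.prod_congr rfl fun k hk => ?_
      rw [Finset.mem_erase] at hk
      exact hdep k hk.2 x i y fun hik => hk.1 (hdisj k hk.2 j hj i hik hij)
    simp only
    rw [← Finset.mul_prod_erase s _ hj, hab, this]
    ring
  · push Not at h
    exact ⟨∏ j ∈ s, g j x, 0, fun y => by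
      rw [zero_mul, add_zero]
      exact Finset.prod_congr rfl fun j hj => hdep j hj x i y (h j hj)⟩

/-- The coordinates can be rounded to `0` or `1` without increasing the function. -/
theorem exists_rounding {G : (ℕ → ℝ) → ℝ} (hG : CoordAffine G) (p : ℕ → ℝ) (h0 : ∀ i, 0 ≤ p i)
    (h1 : ∀ i, p i ≤ 1) (n : ℕ) :
    ∃ ξ : ℕ → ℝ, (∀ i < n, ξ i = 0 ∨ ξ i = 1) ∧ (∀ i, n ≤ i → ξ i = p i) ∧ G ξ ≤ G p := by
  induction n with
  | zero => exact ⟨p, by simp, by simp, le_rfl⟩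
  | succ n ih =>
    obtain ⟨ξ, hξ, hξp, hle⟩ := ih
    obtain ⟨a, b, hab⟩ := hG ξ n
    have hself : G ξ = a + b * p n := by rw [← hab, ← hξp n le_rfl, Function.update_eq_self]
    -- An affine function on `[0, 1]` attains its minimum at an endpoint, determined by the sign of
    -- the slope.
    obtain ⟨z, hz, hzle⟩ : ∃ z : ℝ, (z = 0 ∨ z = 1) ∧ a + b * z ≤ a + b * p n := by
      rcases le_total 0 b with hb | hb
      · exact ⟨0, Or.inl rfl, by nlinarith [h0 n]⟩
      · exact ⟨1, Or.inr rfl, by nlinarith [h1 n]⟩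
    refine ⟨Function.update ξ n z, fun i hi => ?_, fun i hi => ?_, ?_⟩
    · rcases eq_or_ne i n with rfl | hne
      · simpa using hz
      · rw [Function.update_of_ne hne]
        exact hξ i (by omega)
    · rw [Function.update_of_ne (by omega)]
      exact hξp i (by omega)
    · rw [hab]
      exact hzle.trans (hself ▸ hle)

end CoordAffine

/-- The indices of the unordered pairs of distinct natural numbers with sum `k`. -/
def halfRange (k : ℕ) : Finset ℕ := (range (k + 1)).filter fun i => 2 * i < k

theorem mem_halfRange {k i : ℕ} : i ∈ halfRange k ↔ 2 * i < k := by
  simp only [halfRange, Finset.mem_filter, Finset.mem_range]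
  omega

/-- The pairs `{i, k - i}` with `2 * i < k` are disjoint and have distinct members, so each
coordinate occurs only once. The middle index is left out because `x i ^ 2` is not affine. -/
theorem coordAffine_prod_pairs (c : ℝ) (k : ℕ) :
    CoordAffine fun x => ∏ i ∈ halfRange k, (1 + c * (x i * x (k - i))) := by
  refine CoordAffine.prod (halfRange k) (fun i => {i, k - i}) ?_ ?_ ?_
  · intro j hj x i
    rw [mem_halfRange] at hj
    by_cases h1 : i = j
    · subst h1
      have : k - i ≠ i := by omega
      exact ⟨1, c * x (k - i), fun y => by simp [Function.update_of_ne this]; ring⟩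
    · by_cases h2 : i = k - j
      · subst h2
        have : j ≠ k - j := by omega
        exact ⟨1, c * x j, fun y => by simp [Function.update_of_ne this]; ring⟩
      · exact ⟨1 + c * (x j * x (k - j)), 0, fun y => by
          simp [Function.update_of_ne (Ne.symm h1), Function.update_of_ne (Ne.symm h2)]⟩
  · intro j _ x i y hi
    simp only [Set.mem_insert_iff, Set.mem_singleton_iff, not_or] at hi
    rw [Function.update_of_ne (Ne.symm hi.1), Function.update_of_ne (Ne.symm hi.2)]
  · intro j hj j' hj' i hi hi'
    rw [mem_halfRange] at hj hj'
    simp only [Set.mem_insert_iff, Set.mem_singleton_iff] at hi hi'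
    omega

theorem coordAffine_prod_single (c : ℝ) (n : ℕ) :
    CoordAffine fun x => ∏ i ∈ range n, (1 + c * x i) := by
  refine CoordAffine.prod (range n) (fun i => {i}) ?_ ?_ ?_
  · intro j _ x i
    by_cases h1 : i = j
    · subst h1
      exact ⟨1, c, fun y => by simp⟩
    · exact ⟨1 + c * x j, 0, fun y => by simp [Function.update_of_ne (Ne.symm h1)]⟩
  · intro j _ x i y hi
    rw [Set.mem_singleton_iff] at hi
    rw [Function.update_of_ne (Ne.symm hi)]
  · intro j _ j' _ i hi hi'
    exact (Set.mem_singleton_iff.1 hi).symm.trans (Set.mem_singleton_iff.1 hi')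

theorem prod_one_add_exp_sub_one_mul {ι : Type*} (s : Finset ι) (q : ι → ℝ) (t : ℝ)
    (hq : ∀ i ∈ s, q i = 0 ∨ q i = 1) :
    ∏ i ∈ s, (1 + (Real.exp t - 1) * q i) = Real.exp (t * ∑ i ∈ s, q i) := by
  rw [Finset.mul_sum, Real.exp_sum]
  refine Finset.prod_congr rfl fun i hi => ?_
  rcases hq i hi with h | h <;> simp [h]

/-- Each factor is at most `exp((exp t - 1) q)`, and `exp t - 1 ≤ t + t²` for `|t| ≤ 1`: every
factor costs at most `t²` in the exponent. -/
theorem prod_one_add_exp_sub_one_mul_le {ι : Type*} (s : Finset ι) (q : ι → ℝ) {t : ℝ}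
    (ht : |t| ≤ 1) (h0 : ∀ i ∈ s, 0 ≤ q i) (h1 : ∀ i ∈ s, q i ≤ 1) :
    ∏ i ∈ s, (1 + (Real.exp t - 1) * q i) ≤ Real.exp (t * ∑ i ∈ s, q i + t ^ 2 * s.card) := by
  have key : t * ∑ i ∈ s, q i + t ^ 2 * s.card = ∑ i ∈ s, (t * q i + t ^ 2) := by
    rw [Finset.sum_add_distrib, Finset.mul_sum, Finset.sum_const, nsmul_eq_mul, mul_comm (t ^ 2)]
  rw [key, Real.exp_sum]
  refine Finset.prod_le_prod (fun i hi => ?_) fun i hi => ?_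
  · nlinarith [Real.exp_pos t, h0 i hi, h1 i hi, mul_nonneg (Real.exp_pos t).le (h0 i hi)]
  · have h2 := (abs_le.1 (Real.abs_exp_sub_one_sub_id_le ht)).2
    have h3 : (Real.exp t - 1) * q i ≤ t * q i + t ^ 2 := by
      nlinarith [h0 i hi, h1 i hi, sq_nonneg t, mul_le_mul_of_nonneg_right h2 (h0 i hi),
        mul_le_mul_of_nonneg_left (h1 i hi) (sq_nonneg t)]
    calc 1 + (Real.exp t - 1) * q i ≤ Real.exp ((Real.exp t - 1) * q i) := by
          linarith [Real.add_one_le_exp ((Real.exp t - 1) * q i)]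
      _ ≤ _ := Real.exp_le_exp.2 h3

/-- Densities on `N` cells can be rounded to `0` and `1` so that no pair correlation increases
much and the total does not decrease much. -/
theorem exists_rounding_pairs (N : ℕ) (p : ℕ → ℝ) (h0 : ∀ i, 0 ≤ p i) (h1 : ∀ i, p i ≤ 1)
    (hN : ∀ i, N ≤ i → p i = 0) {t : ℝ} (ht0 : 0 < t) (ht1 : t ≤ 1) :
    ∃ ξ : ℕ → ℝ, (∀ i, ξ i = 0 ∨ ξ i = 1) ∧ (∀ i, N ≤ i → ξ i = 0) ∧
      (∀ k < 2 * N, ∑ i ∈ halfRange k, ξ i * ξ (k - i) ≤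
        ∑ i ∈ halfRange k, p i * p (k - i) + (2 * t * N + Real.log (2 * N + 1) / t)) ∧
      ∑ i ∈ range N, p i ≤ ∑ i ∈ range N, ξ i + (2 * t * N + Real.log (2 * N + 1) / t) := by
  set Z : ℕ → (ℕ → ℝ) → ℝ := fun k x => ∑ i ∈ halfRange k, x i * x (k - i) with hZ
  -- For independent Bernoulli variables with means `x`, `G₁ k x` is the expected exponential of `t`
  -- times the excess of the `k`-th pair sum over `Z k p`; `G₂ x` does the same for the deficit of
  -- the total. A rounding that does not increase their sum controls all these deviations at once.
  set G₁ : ℕ → (ℕ → ℝ) → ℝ := fun k x => Real.exp (-(t * Z k p)) *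
    ∏ i ∈ halfRange k, (1 + (Real.exp t - 1) * (x i * x (k - i))) with hG₁
  set G₂ : (ℕ → ℝ) → ℝ := fun x => Real.exp (t * ∑ i ∈ range N, p i) *
    ∏ i ∈ range N, (1 + (Real.exp (-t) - 1) * x i) with hG₂
  have hA : CoordAffine fun x => ∑ k ∈ range (2 * N), G₁ k x + G₂ x :=
    (CoordAffine.sum _ fun k _ => (coordAffine_prod_pairs _ k).const_mul _).add
      ((coordAffine_prod_single _ N).const_mul _)
  obtain ⟨ξ, hξ, hξp, hle⟩ := hA.exists_rounding p h0 h1 N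
  have hξN : ∀ i, N ≤ i → ξ i = 0 := fun i hi => (hξp i hi).trans (hN i hi)
  have hξ01 : ∀ i, ξ i = 0 ∨ ξ i = 1 := fun i =>
    (lt_or_ge i N).elim (hξ i) fun h => Or.inl (hξN i h)
  have e1 : ∀ k, G₁ k ξ = Real.exp (t * (Z k ξ - Z k p)) := by
    intro k
    simp only [hG₁]
    rw [prod_one_add_exp_sub_one_mul, ← Real.exp_add]
    · congr 1; simp only [hZ]; ring
    · intro i _
      rcases hξ01 i with h | h <;> rcases hξ01 (k - i) with h' | h' <;> simp [h, h']
  have e2 : G₂ ξ = Real.exp (t * (∑ i ∈ range N, p i - ∑ i ∈ range N, ξ i)) := by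
    simp only [hG₂]
    rw [prod_one_add_exp_sub_one_mul _ _ _ fun i _ => hξ01 i, ← Real.exp_add]
    congr 1; ring
  have b1 : ∀ k ∈ range (2 * N), G₁ k p ≤ Real.exp (2 * t ^ 2 * N) := by
    intro k hk
    have hc : ((halfRange k).card : ℝ) ≤ 2 * N := by
      have : (halfRange k).card ≤ k + 1 := (Finset.card_filter_le _ _).trans (by simp)
      rw [Finset.mem_range] at hk
      exact_mod_cast this.trans hk
    simp only [hG₁]
    calc _ ≤ Real.exp (-(t * Z k p)) * Real.exp (t * Z k p + t ^ 2 * (halfRange k).card) := by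
          gcongr
          exact prod_one_add_exp_sub_one_mul_le _ _ (by rwa [abs_of_pos ht0])
            (fun i _ => mul_nonneg (h0 _) (h0 _)) fun i _ => mul_le_one₀ (h1 _) (h0 _) (h1 _)
      _ = Real.exp (t ^ 2 * (halfRange k).card) := by rw [← Real.exp_add]; congr 1; ring
      _ ≤ _ := Real.exp_le_exp.2 (by nlinarith [sq_nonneg t])
  have b2 : G₂ p ≤ Real.exp (2 * t ^ 2 * N) := by
    simp only [hG₂]
    calc _ ≤ Real.exp (t * ∑ i ∈ range N, p i) *
          Real.exp (-t * ∑ i ∈ range N, p i + (-t) ^ 2 * (range N).card) := by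
          gcongr
          exact prod_one_add_exp_sub_one_mul_le _ _ (by rwa [abs_neg, abs_of_pos ht0])
            (fun i _ => h0 _) fun i _ => h1 _
      _ = Real.exp (t ^ 2 * N) := by
          rw [← Real.exp_add, Finset.card_range]; congr 1; ring
      _ ≤ _ := Real.exp_le_exp.2 (by
          have : (0 : ℝ) ≤ t ^ 2 * N := by positivity
          linarith)
  have tot : ∑ k ∈ range (2 * N), G₁ k ξ + G₂ ξ ≤ (2 * N + 1) * Real.exp (2 * t ^ 2 * N) := by
    refine hle.trans ((add_le_add (Finset.sum_le_sum b1) b2).trans_eq ?_)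
    rw [Finset.sum_const, Finset.card_range, nsmul_eq_mul]
    push_cast
    ring
  have n1 : ∀ k, 0 ≤ G₁ k ξ := fun k => by rw [e1]; positivity
  have n2 : 0 ≤ G₂ ξ := by rw [e2]; positivity
  -- Each nonnegative summand is bounded by the whole sum; taking logarithms and dividing by `t`
  -- gives the error term.
  have fin : ∀ u : ℝ, Real.exp (t * u) ≤ (2 * N + 1) * Real.exp (2 * t ^ 2 * N) →
      u ≤ 2 * t * N + Real.log (2 * N + 1) / t := by
    intro u hu
    have h := Real.log_le_log (Real.exp_pos _) hu
    rw [Real.log_exp, Real.log_mul (by positivity) (Real.exp_pos _).ne', Real.log_exp] at h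
    rw [show 2 * t * N + Real.log (2 * N + 1) / t =
      (Real.log (2 * N + 1) + 2 * t ^ 2 * N) / t by field_simp; ring, le_div_iff₀ ht0]
    linarith
  refine ⟨ξ, hξ01, hξN, fun k hk => ?_, ?_⟩
  · have : G₁ k ξ ≤ ∑ k ∈ range (2 * N), G₁ k ξ :=
      Finset.single_le_sum (fun j _ => n1 j) (Finset.mem_range.2 hk)
    have := fin (Z k ξ - Z k p) (by rw [← e1]; linarith)
    simp only [hZ] at this
    linarith
  · have := Finset.sum_nonneg fun k (_ : k ∈ range (2 * N)) => n1 k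
    have := fin (∑ i ∈ range N, p i - ∑ i ∈ range N, ξ i) (by rw [← e2]; linarith)
    linarith

theorem sum_range_succ_mul_reflect (x : ℕ → ℝ) (k : ℕ) :
    ∑ i ∈ range (k + 1), x i * x (k - i) = 2 * ∑ i ∈ halfRange k, x i * x (k - i) +
      ∑ i ∈ (range (k + 1)).filter (fun i => 2 * i = k), x i * x (k - i) := by
  have h1 : ∑ i ∈ (range (k + 1)).filter (fun i => k < 2 * i), x i * x (k - i) =
      ∑ i ∈ halfRange k, x i * x (k - i) := by
    refine Finset.sum_nbij' (fun i => k - i) (fun i => k - i) ?_ ?_ ?_ ?_ ?_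
    · intro i hi; rw [mem_halfRange]; simp at hi; omega
    · intro i hi; rw [mem_halfRange] at hi; simp; omega
    · intro i hi; simp at hi; omega
    · intro i hi; rw [mem_halfRange] at hi; omega
    · intro i hi
      simp at hi
      rw [show k - (k - i) = i by omega, mul_comm]
  have h2 := Finset.sum_filter_add_sum_filter_not (range (k + 1)) (fun i => 2 * i < k)
    fun i => x i * x (k - i)
  have h3 := Finset.sum_filter_add_sum_filter_not
    ((range (k + 1)).filter fun i => ¬ 2 * i < k) (fun i => k < 2 * i) fun i => x i * x (k - i)
  rw [Finset.filter_filter, Finset.filter_filter] at h3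
  have h4 : (range (k + 1)).filter (fun i => ¬ 2 * i < k ∧ k < 2 * i) =
      (range (k + 1)).filter fun i => k < 2 * i :=
    Finset.filter_congr fun i _ => by omega
  have h5 : (range (k + 1)).filter (fun i => ¬ 2 * i < k ∧ ¬ k < 2 * i) =
      (range (k + 1)).filter fun i => 2 * i = k :=
    Finset.filter_congr fun i _ => by omega
  rw [h4, h5, h1] at h3
  rw [← h2, ← h3]
  simp only [halfRange]
  ring

theorem sum_diagonal_le_one {x : ℕ → ℝ} (h0 : ∀ i, 0 ≤ x i) (h1 : ∀ i, x i ≤ 1) (k : ℕ) :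
    ∑ i ∈ (range (k + 1)).filter (fun i => 2 * i = k), x i * x (k - i) ≤ 1 := by
  calc _ ≤ ∑ i ∈ (range (k + 1)).filter (fun i => 2 * i = k), (1 : ℝ) :=
        Finset.sum_le_sum fun i _ => mul_le_one₀ (h1 _) (h0 _) (h1 _)
    _ = ((range (k + 1)).filter (fun i => 2 * i = k)).card := by simp
    _ ≤ 1 := by
        have : ((range (k + 1)).filter (fun i => 2 * i = k)).card ≤ 1 :=
          Finset.card_le_one.2 fun a ha b hb => by
            simp only [Finset.mem_filter] at ha hb
            omega
        exact_mod_cast this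

/-! ### From `0`–`1` sequences to subsets of `[0, 1)`. -/

/-- The union of the cells `[i / N, (i + 1) / N)` with `ξ i = 1`. -/
def cellSet (N : ℕ) (ξ : ℕ → ℝ) : Set ℝ := {x | 0 ≤ x ∧ ξ ⌊N * x⌋₊ = 1}

theorem measurableSet_cellSet (N : ℕ) (ξ : ℕ → ℝ) : MeasurableSet (cellSet N ξ) := by
  have h : Measurable fun x : ℝ => ⌊(N : ℝ) * x⌋₊ :=
    Nat.measurable_floor.comp (by fun_prop)
  exact measurableSet_Ici.inter (h (MeasurableSet.of_discrete (s := {i | ξ i = 1})))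

section Cells

variable {N : ℕ} {ξ : ℕ → ℝ}

theorem cellSet_subset (hN : 0 < N) (hξN : ∀ i, N ≤ i → ξ i = 0) : cellSet N ξ ⊆ Ico 0 1 := by
  rintro x ⟨hx, hx1⟩
  refine ⟨hx, ?_⟩
  by_contra! h
  have hN' : (0 : ℝ) < N := by exact_mod_cast hN
  rw [hξN _ (Nat.le_floor (by nlinarith))] at hx1
  exact zero_ne_one hx1

theorem floor_mul_cell_add (hN : 0 < N) (i : ℕ) {r : ℝ} (hr : r ∈ Ico 0 (1 / (N : ℝ))) :
    ⌊(N : ℝ) * (i / N + r)⌋₊ = i := by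
  have hN' : (0 : ℝ) < N := by exact_mod_cast hN
  have h2 : N * r < 1 := by
    have := (lt_div_iff₀ hN').1 hr.2
    linarith
  have h1 : (N : ℝ) * (i / N + r) = i + N * r := by field_simp
  have h3 : 0 ≤ N * r := mul_nonneg hN'.le hr.1
  rw [h1, Nat.floor_eq_iff (by positivity)]
  constructor <;> linarith

/-- The measure of a subset of `[0, 1)`, folded into one cell. -/
theorem volume_eq_lintegral_cells (hN : 0 < N) {B : Set ℝ} (hB : MeasurableSet B)
    (hB01 : B ⊆ Ico 0 1) :
    volume B = ∫⁻ r in Ico 0 (1 / (N : ℝ)), ∑ i ∈ range N, B.indicator 1 (i / N + r) := by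
  have hN' : (0 : ℝ) < N := by exact_mod_cast hN
  set cell : ℕ → Set ℝ := fun i => Ico ((i : ℝ) / N) (i / N + 1 / N) with hcell
  have hmem : ∀ i x, x ∈ cell i ↔ 0 ≤ x ∧ ⌊(N : ℝ) * x⌋₊ = i := by
    intro i x
    have e : (N : ℝ) * (i / N) = i := by field_simp
    have e' : (N : ℝ) * (i / N + 1 / N) = i + 1 := by field_simp
    constructor
    · rintro ⟨h1, h2⟩
      have h0 : 0 ≤ x := le_trans (by positivity) h1
      refine ⟨h0, (Nat.floor_eq_iff (by positivity)).2 ⟨?_, ?_⟩⟩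
      · rw [← e]; gcongr
      · rw [← e']; gcongr
    · rintro ⟨h0, h⟩
      rw [Nat.floor_eq_iff (by positivity), ← e'] at h
      nth_rw 1 [← e] at h
      exact ⟨le_of_mul_le_mul_left h.1 hN', lt_of_mul_lt_mul_left h.2 hN'.le⟩
  have hU : B = ⋃ i ∈ range N, B ∩ cell i := by
    ext x
    simp only [Set.mem_iUnion, Set.mem_inter_iff, exists_prop, Finset.mem_range]
    refine ⟨fun hx => ⟨⌊(N : ℝ) * x⌋₊, ?_, hx, (hmem _ _).2 ⟨(hB01 hx).1, rfl⟩⟩,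
      fun ⟨i, _, h, _⟩ => h⟩
    rw [Nat.floor_lt (mul_nonneg hN'.le (hB01 hx).1)]
    nlinarith [(hB01 hx).2]
  have hm : ∀ i, MeasurableSet (B ∩ cell i) := fun i => hB.inter measurableSet_Ico
  have hmi : ∀ i : ℕ, Measurable fun r : ℝ => B.indicator (1 : ℝ → ℝ≥0∞) ((i : ℝ) / N + r) :=
    fun i => (measurable_one.indicator hB).comp (by fun_prop)
  conv_lhs => rw [hU]
  rw [measure_biUnion_finset (fun i _ j _ hij => Set.disjoint_left.2 fun x hx hx' =>
      hij (((hmem _ _).1 hx.2).2.symm.trans ((hmem _ _).1 hx'.2).2)) fun i _ => hm i,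
    lintegral_finsetSum _ fun i _ => hmi i]
  refine Finset.sum_congr rfl fun i _ => ?_
  rw [← lintegral_indicator_one (hm i),
    ← lintegral_add_left_eq_self ((B ∩ cell i).indicator 1) ((i : ℝ) / N),
    ← lintegral_indicator measurableSet_Ico]
  refine lintegral_congr fun r => ?_
  have : (i : ℝ) / N + r ∈ cell i ↔ r ∈ Ico 0 (1 / (N : ℝ)) := by
    simp only [hcell, Set.mem_Ico]
    constructor <;> rintro ⟨h1, h2⟩ <;> constructor <;> linarith
  by_cases h1 : r ∈ Ico 0 (1 / (N : ℝ)) <;> by_cases h2 : (i : ℝ) / N + r ∈ B <;>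
    simp only [Set.indicator, Set.mem_inter_iff, this, h1, h2] <;> simp

theorem volume_cellSet (hN : 0 < N) (hξ : ∀ i, ξ i = 0 ∨ ξ i = 1)
    (hξN : ∀ i, N ≤ i → ξ i = 0) :
    volume (cellSet N ξ) = ENNReal.ofReal ((∑ i ∈ range N, ξ i) / N) := by
  have hN' : (0 : ℝ) < N := by exact_mod_cast hN
  have hnn : ∀ i, 0 ≤ ξ i := fun i => by rcases hξ i with h | h <;> simp [h]
  rw [volume_eq_lintegral_cells hN (measurableSet_cellSet N ξ) (cellSet_subset hN hξN),
    setLIntegral_congr_fun (g := fun _ => ENNReal.ofReal (∑ i ∈ range N, ξ i)) measurableSet_Ico,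
    setLIntegral_const, Real.volume_Ico, sub_zero,
    ← ENNReal.ofReal_mul (Finset.sum_nonneg fun i _ => hnn i), mul_one_div]
  intro r hr
  simp only
  rw [ENNReal.ofReal_sum_of_nonneg fun i _ => hnn i]
  refine Finset.sum_congr rfl fun i _ => ?_
  have h0 : (0 : ℝ) ≤ i / N + r := add_nonneg (by positivity) hr.1
  rcases hξ i with h | h <;>
    simp [Set.indicator, cellSet, floor_mul_cell_add hN i hr, h, h0]

/-- For a fixed offset `r` in the cell, the reflection sends the point `i / N + r` to cell `k - i`
with `k = ⌊N (s - r)⌋`, independent of `i`. So each offset contributes at most one value of the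
discrete autoconvolution. -/
theorem volume_cellSet_inter_reflect_le (hN : 0 < N) (hξ : ∀ i, ξ i = 0 ∨ ξ i = 1)
    (hξN : ∀ i, N ≤ i → ξ i = 0) {R : ℝ} (hR : 0 ≤ R)
    (hle : ∀ k < 2 * N, ∑ i ∈ range (k + 1), ξ i * ξ (k - i) ≤ R) (s : ℝ) :
    volume (cellSet N ξ ∩ (fun x => s - x) ⁻¹' cellSet N ξ) ≤ ENNReal.ofReal (R / N) := by
  have hN' : (0 : ℝ) < N := by exact_mod_cast hN
  have hnn : ∀ i, 0 ≤ ξ i := fun i => by rcases hξ i with h | h <;> simp [h]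
  have hA := measurableSet_cellSet N ξ
  have hm : MeasurableSet (cellSet N ξ ∩ (fun x => s - x) ⁻¹' cellSet N ξ) :=
    hA.inter ((by fun_prop : Measurable fun x : ℝ => s - x) hA)
  rw [volume_eq_lintegral_cells hN hm (Set.inter_subset_left.trans (cellSet_subset hN hξN))]
  calc _ ≤ ∫⁻ r in Ico 0 (1 / (N : ℝ)), ENNReal.ofReal R := ?_
    _ = _ := by
      rw [setLIntegral_const, Real.volume_Ico, sub_zero, ← ENNReal.ofReal_mul hR, mul_one_div]
  refine setLIntegral_mono measurable_const fun r hr => ?_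
  have hk : ∀ i ∈ range N, (i : ℝ) / N + r ∈ cellSet N ξ ∩ (fun x => s - x) ⁻¹' cellSet N ξ →
      ξ i = 1 ∧ i ≤ ⌊N * (s - r)⌋₊ ∧ ξ (⌊N * (s - r)⌋₊ - i) = 1 := by
    rintro i - ⟨⟨h1, h2⟩, h3, h4⟩
    rw [floor_mul_cell_add hN i hr] at h2
    have e : (N : ℝ) * (s - (i / N + r)) = N * (s - r) - i := by field_simp; ring
    have h5 : 0 ≤ (N : ℝ) * (s - r) - i := by rw [← e]; exact mul_nonneg hN'.le h3
    refine ⟨h2, Nat.le_floor (by linarith), ?_⟩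
    rwa [e, Nat.floor_sub_natCast] at h4
  set k := ⌊N * (s - r)⌋₊ with hkdef
  by_cases hk2 : k < 2 * N
  · refine le_trans ?_ (ENNReal.ofReal_le_ofReal (hle k hk2))
    have hstep : ∑ i ∈ range N, (cellSet N ξ ∩ (fun x => s - x) ⁻¹' cellSet N ξ).indicator
        (1 : ℝ → ℝ≥0∞) (i / N + r) ≤
        ∑ i ∈ range N, if i ≤ k then ENNReal.ofReal (ξ i * ξ (k - i)) else 0 := by
      refine Finset.sum_le_sum fun i hi => ?_
      by_cases hmem : (i : ℝ) / N + r ∈ cellSet N ξ ∩ (fun x => s - x) ⁻¹' cellSet N ξ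
      · obtain ⟨h1, h2, h3⟩ := hk i hi hmem
        simp [Set.indicator_of_mem hmem, h1, h2, h3]
      · rw [Set.indicator_of_notMem hmem]
        exact zero_le
    refine hstep.trans ?_
    rw [← Finset.sum_filter, ENNReal.ofReal_sum_of_nonneg fun i _ => mul_nonneg (hnn _) (hnn _)]
    refine Finset.sum_le_sum_of_subset fun i hi => ?_
    simp only [Finset.mem_filter, Finset.mem_range] at hi ⊢
    omega
  · refine le_trans (le_of_eq (Finset.sum_eq_zero fun i hi => ?_)) zero_le
    refine Set.indicator_of_notMem (fun hmem => ?_) _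
    obtain ⟨h1, h2, h3⟩ := hk i hi hmem
    rw [Finset.mem_range] at hi
    rw [hξN _ (by omega)] at h3
    exact zero_ne_one h3

end Cells

/-- Rounding of densities: thin sets exist if there are densities on arbitrarily many cells with
total about `a` and autoconvolution about `M`. -/
theorem hasThinSets_of_densities {a M : ℝ} (hM : 0 ≤ M)
    (h : ∀ η : ℝ, 0 < η → ∃ᶠ N : ℕ in Filter.atTop, ∃ p : ℕ → ℝ, (∀ i, 0 ≤ p i) ∧
      (∀ i, p i ≤ 1) ∧ (∀ i, N ≤ i → p i = 0) ∧ (a - η) * N ≤ ∑ i ∈ range N, p i ∧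
      ∀ k, ∑ i ∈ range (k + 1), p i * p (k - i) ≤ (M + η) * N) :
    HasThinSets a M := by
  intro η hη
  -- The autoconvolution loses `t N` from the densities, twice the rounding error `3 t N`, and `1 ≤
  -- t N` from the diagonal: `8 t N` in all.
  obtain ⟨t, ht0, ht1, htη⟩ : ∃ t : ℝ, 0 < t ∧ t ≤ 1 ∧ 8 * t ≤ η :=
    ⟨min 1 (η / 8), by positivity, min_le_left _ _, by
      have := min_le_right 1 (η / 8); linarith⟩
  have hlog : ∀ᶠ N : ℕ in Filter.atTop, Real.log (2 * N + 1) ≤ t ^ 2 * N ∧ 1 ≤ t * N := by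
    have h1 : ∀ᶠ x : ℝ in Filter.atTop, Real.log x ≤ t ^ 2 / 4 * x := by
      have := Real.isLittleO_log_id_atTop.bound (show 0 < t ^ 2 / 4 by positivity)
      filter_upwards [this, Filter.eventually_ge_atTop 1] with x hx hx1
      have h2 := (le_abs_self _).trans hx
      rwa [id, Real.norm_eq_abs, abs_of_nonneg (by linarith)] at h2
    have h2 : Filter.Tendsto (fun N : ℕ => 2 * (N : ℝ) + 1) Filter.atTop Filter.atTop :=
      Filter.tendsto_atTop_add_const_right _ _
        (tendsto_natCast_atTop_atTop.const_mul_atTop (by norm_num))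
    have h3 : ∀ᶠ N : ℕ in Filter.atTop, 1 ≤ t * (N : ℝ) :=
      (tendsto_natCast_atTop_atTop.const_mul_atTop ht0).eventually_ge_atTop 1
    filter_upwards [h2.eventually h1, h3, Filter.eventually_ge_atTop 1] with N hN hN3 hN1
    refine ⟨?_, hN3⟩
    have : (1 : ℝ) ≤ N := by exact_mod_cast hN1
    nlinarith [sq_nonneg t]
  obtain ⟨N, ⟨p, h0, h1, hpN, hsum, hconv⟩, hN1, hN2⟩ := ((h t ht0).and_eventually hlog).exists
  have hN' : (0 : ℝ) < N := by
    by_contra! hcon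
    nlinarith
  have hN : 0 < N := by exact_mod_cast hN'
  obtain ⟨ξ, hξ, hξN, hpairs, htot⟩ := exists_rounding_pairs N p h0 h1 hpN ht0 ht1
  have herr : 2 * t * N + Real.log (2 * N + 1) / t ≤ 3 * t * N := by
    have : Real.log (2 * N + 1) / t ≤ t * N := by
      rw [div_le_iff₀ ht0]; linarith
    linarith
  have hξ0 : ∀ i, 0 ≤ ξ i := fun i => by rcases hξ i with h | h <;> simp [h]
  have hξ1 : ∀ i, ξ i ≤ 1 := fun i => by rcases hξ i with h | h <;> simp [h]
  refine ⟨cellSet N ξ, cellSet_subset hN hξN, measurableSet_cellSet N ξ, ?_, fun s => ?_⟩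
  · rw [volume_cellSet hN hξ hξN]
    refine ENNReal.ofReal_le_ofReal ((le_div_iff₀ hN').2 ?_)
    nlinarith
  · have hR : 0 ≤ (M + η) * N := by positivity
    refine (volume_cellSet_inter_reflect_le hN hξ hξN hR (fun k hk => ?_) s).trans_eq ?_
    · have e1 := sum_range_succ_mul_reflect ξ k
      have e2 := sum_range_succ_mul_reflect p k
      have e3 := sum_diagonal_le_one hξ0 hξ1 k
      have e4 : 0 ≤ ∑ i ∈ (range (k + 1)).filter (fun i => 2 * i = k), p i * p (k - i) :=
        Finset.sum_nonneg fun i _ => mul_nonneg (h0 _) (h0 _)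
      have e5 := hpairs k hk
      have e6 := hconv k
      nlinarith
    · rw [mul_div_assoc, div_self hN'.ne', mul_one]

/-! ### The eight-step density. -/

/-- Densities on eight equal intervals with total `11 / 2` and autoconvolution at most `3`. -/
noncomputable def blockDensity : ℕ → ℝ
  | 0 => 1
  | 1 => 1
  | 2 => 1
  | 4 => 1
  | 5 => 1 / 2
  | 7 => 1
  | _ => 0

theorem blockDensity_nonneg (a : ℕ) : 0 ≤ blockDensity a := by
  unfold blockDensity; split <;> norm_num

theorem blockDensity_le_one (a : ℕ) : blockDensity a ≤ 1 := by
  unfold blockDensity; split <;> norm_num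

theorem blockDensity_of_le {a : ℕ} (h : 8 ≤ a) : blockDensity a = 0 := by
  unfold blockDensity; split <;> first | omega | rfl

theorem blockDensity_conv_le (c : ℕ) :
    ∑ a ∈ range 8, (if a ≤ c then blockDensity a * blockDensity (c - a) else 0) ≤ 3 := by
  by_cases hc : c < 15
  · interval_cases c <;> norm_num [Finset.sum_range_succ, blockDensity]
  · refine (Finset.sum_eq_zero fun a ha => ?_).trans_le (by norm_num)
    rw [Finset.mem_range] at ha
    rw [blockDensity_of_le (a := c - a) (by omega)]
    simp

theorem sum_range_mul_blocks (f : ℕ → ℝ) (n m : ℕ) :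
    ∑ i ∈ range (n * m), f i = ∑ a ∈ range n, ∑ r ∈ range m, f (a * m + r) := by
  induction n with
  | zero => simp
  | succ n ih => rw [add_mul, one_mul, Finset.sum_range_add, ih, Finset.sum_range_succ]

theorem hasThinSets_blocks {ε : ℝ} (h0 : 0 ≤ ε) (h1 : ε ≤ 11 / 16) :
    HasThinSets ε (96 / 121 * ε ^ 2) := by
  refine hasThinSets_of_densities (by positivity) fun η hη => ?_
  refine Filter.frequently_atTop.2 fun N₀ => ?_
  set m := N₀ + 1 with hm
  have hm0 : 0 < m := by omega
  -- The block density has mean `11/16`, so the factor `16/11 * ε` gives mean `ε` and stays at most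
  -- `1` exactly up to `ε = 11/16`. The constant is `3/8 * (16/11)² = 96/121`.
  refine ⟨8 * m, by omega, fun i => 16 / 11 * ε * blockDensity (i / m), fun i => ?_, fun i => ?_,
    fun i hi => ?_, ?_, fun k => ?_⟩
  · have := blockDensity_nonneg (i / m)
    positivity
  · have := blockDensity_le_one (i / m)
    have := blockDensity_nonneg (i / m)
    nlinarith
  · simp only
    rw [blockDensity_of_le ((Nat.le_div_iff_mul_le hm0).2 hi), mul_zero]
  · rw [← Finset.mul_sum, sum_range_mul_blocks]
    have : ∀ a ∈ range 8, ∑ r ∈ range m, blockDensity ((a * m + r) / m) = m * blockDensity a := by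
      intro a _
      rw [Finset.sum_congr rfl fun r hr => ?_, Finset.sum_const, Finset.card_range, nsmul_eq_mul]
      rw [mul_comm, Nat.mul_add_div hm0, Nat.div_eq_of_lt (Finset.mem_range.1 hr), add_zero]
    rw [Finset.sum_congr rfl this, ← Finset.mul_sum]
    have : ∑ a ∈ range 8, blockDensity a = 11 / 2 := by
      norm_num [Finset.sum_range_succ, blockDensity]
    rw [this]
    push_cast
    have : 0 ≤ η * m := by positivity
    linarith
  · set q : ℕ → ℝ := fun i => if i ≤ k then blockDensity (i / m) * blockDensity ((k - i) / m) else 0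
      with hq
    have hq0 : ∀ i, 0 ≤ q i := fun i => by
      simp only [hq]
      split
      · exact mul_nonneg (blockDensity_nonneg _) (blockDensity_nonneg _)
      · exact le_rfl
    have e1 : ∑ i ∈ range (k + 1), 16 / 11 * ε * blockDensity (i / m) *
        (16 / 11 * ε * blockDensity ((k - i) / m)) =
        (16 / 11 * ε) ^ 2 * ∑ i ∈ range (k + 1), q i := by
      rw [Finset.mul_sum]
      refine Finset.sum_congr rfl fun i hi => ?_
      rw [Finset.mem_range] at hi
      simp only [hq, if_pos (show i ≤ k by omega)]
      ring
    have e2 : ∑ i ∈ range (k + 1), q i ≤ ∑ i ∈ range (8 * m), q i := by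
      rw [← Finset.sum_filter_add_sum_filter_not (range (k + 1)) (fun i => i < 8 * m)]
      have hz : ∑ i ∈ (range (k + 1)).filter (fun i => ¬ i < 8 * m), q i = 0 := by
        refine Finset.sum_eq_zero fun i hi => ?_
        simp only [Finset.mem_filter, not_lt] at hi
        simp [hq, blockDensity_of_le ((Nat.le_div_iff_mul_le hm0).2 hi.2)]
      rw [hz, add_zero]
      refine Finset.sum_le_sum_of_subset_of_nonneg (fun i hi => ?_) fun i _ _ => hq0 i
      simp only [Finset.mem_filter] at hi
      exact Finset.mem_range.2 hi.2
    -- With `i = a * m + r` and `r` fixed, the block of `k - i` is `(k - r) / m - a`, so each `r`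
    -- contributes at most one value of the block autoconvolution.
    have e3 : ∑ i ∈ range (8 * m), q i ≤ m * 3 := by
      rw [sum_range_mul_blocks, Finset.sum_comm]
      calc _ ≤ ∑ r ∈ range m, (3 : ℝ) := Finset.sum_le_sum fun r hr => ?_
        _ = _ := by simp
      rw [Finset.mem_range] at hr
      refine le_trans (Finset.sum_le_sum fun a _ => ?_) (blockDensity_conv_le ((k - r) / m))
      simp only [hq]
      have d1 : (a * m + r) / m = a := by
        rw [mul_comm, Nat.mul_add_div hm0, Nat.div_eq_of_lt hr, add_zero]
      by_cases hle : a * m + r ≤ k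
      · have d2 : a ≤ (k - r) / m := (Nat.le_div_iff_mul_le hm0).2 (by omega)
        have d3 : (k - (a * m + r)) / m = (k - r) / m - a := by
          rw [show k - (a * m + r) = k - r - m * a by rw [mul_comm m a]; omega, Nat.sub_mul_div]
        rw [if_pos hle, if_pos d2, d1, d3]
      · rw [if_neg hle]
        split
        · exact mul_nonneg (blockDensity_nonneg _) (blockDensity_nonneg _)
        · exact le_rfl
    have e4 := e2.trans e3
    simp only
    rw [e1]
    push_cast
    have : 0 ≤ η * m := by positivity
    have := mul_le_mul_of_nonneg_left e4 (sq_nonneg (16 / 11 * ε))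
    nlinarith

/-! ### The density `min(1, b/√x)`. -/

/-- Discrete form of `∫ dx / √(x (n - x)) = π` over `[0, n]`: the right side is the integral over
`[i, i + 1]`, where `x ≤ i + 1` and `n - x ≤ n - i`. With `n = k + 1` these bounds telescope to `π`.
-/
theorem inv_sqrt_le_arcsin_sub {n i : ℕ} (hi : i < n) :
    1 / Real.sqrt ((i + 1) * (n - i)) ≤
      Real.arcsin (2 * (i + 1 : ℕ) / n - 1) - Real.arcsin (2 * i / n - 1) := by
  have hn : (0 : ℝ) < n := by exact_mod_cast (by omega : 0 < n)
  have hin : (i : ℝ) + 1 ≤ n := by exact_mod_cast hi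
  have hder : ∀ x ∈ interior (Icc (i : ℝ) (i + 1)), HasDerivAt
      (fun x : ℝ => Real.arcsin (2 * x / n - 1)) (1 / Real.sqrt (x * (n - x))) x := by
    intro x hx
    rw [interior_Icc] at hx
    have hi0 : (0 : ℝ) ≤ i := by positivity
    have hx0 : 0 < x := by linarith [hx.1]
    have hxn : x < n := by linarith [hx.2]
    have h1 : 2 * x / n - 1 ≠ -1 := by
      have : 0 < 2 * x / n := by positivity
      linarith
    have h2 : 2 * x / n - 1 ≠ 1 := by
      have : 2 * x / n < 2 := by rw [div_lt_iff₀ hn]; linarith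
      linarith
    have h3 : HasDerivAt (fun x : ℝ => 2 * x / n - 1) (2 / n) x := by
      simpa using (((hasDerivAt_id x).const_mul 2).div_const (n : ℝ)).sub_const 1
    have h4 := (Real.hasDerivAt_arcsin h1 h2).comp x h3
    convert! h4 using 1
    have h5 : 1 - (2 * x / n - 1) ^ 2 = (2 / n) ^ 2 * (x * (n - x)) := by field_simp; ring
    rw [h5, Real.sqrt_mul (sq_nonneg (2 / (n : ℝ))), Real.sqrt_sq (by positivity)]
    have h6 : 0 < Real.sqrt (x * (n - x)) := Real.sqrt_pos.2 (mul_pos hx0 (by linarith))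
    field_simp
  have key := (convex_Icc (i : ℝ) (i + 1)).mul_sub_le_image_sub_of_le_deriv
    (f := fun x : ℝ => Real.arcsin (2 * x / n - 1)) (C := 1 / Real.sqrt ((i + 1) * (n - i)))
    (Real.continuous_arcsin.comp (by fun_prop)).continuousOn
    (fun x hx => (hder x hx).differentiableAt.differentiableWithinAt)
    (fun x hx => by
      rw [(hder x hx).deriv]
      rw [interior_Icc] at hx
      have hi0 : (0 : ℝ) ≤ i := by positivity
      have hpos : 0 < x * (n - x) := mul_pos (by linarith [hx.1]) (by linarith [hx.2])
      exact one_div_le_one_div_of_le (Real.sqrt_pos.2 hpos)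
        (Real.sqrt_le_sqrt (mul_le_mul hx.2.le (by linarith [hx.1]) (by linarith [hx.2])
          (by linarith))))
    i (by simp) (i + 1) (by simp) (by linarith)
  simpa using key

theorem sum_inv_sqrt_mul_reflect_le_pi (k : ℕ) :
    ∑ i ∈ range (k + 1), 1 / Real.sqrt ((i + 1) * ((k - i : ℕ) + 1)) ≤ Real.pi := by
  calc ∑ i ∈ range (k + 1), 1 / Real.sqrt ((i + 1) * ((k - i : ℕ) + 1))
      ≤ ∑ i ∈ range (k + 1), (Real.arcsin (2 * (i + 1 : ℕ) / (k + 1 : ℕ) - 1) -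
          Real.arcsin (2 * i / (k + 1 : ℕ) - 1)) := by
        refine Finset.sum_le_sum fun i hi => ?_
        rw [Finset.mem_range] at hi
        refine le_trans (le_of_eq ?_) (inv_sqrt_le_arcsin_sub hi)
        rw [Nat.cast_sub (by omega)]
        push_cast
        congr 3
        ring
    _ = Real.pi := by
        rw [Finset.sum_range_sub (fun i : ℕ => Real.arcsin (2 * i / (k + 1 : ℕ) - 1))]
        have : (2 : ℝ) * (k + 1 : ℕ) / (k + 1 : ℕ) - 1 = 1 := by
          rw [mul_div_assoc, div_self (by positivity)]; norm_num
        rw [this]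
        norm_num

theorem two_mul_sqrt_sub_le {x : ℝ} (hx : 0 < x) :
    2 * (Real.sqrt (x + 1) - Real.sqrt x) ≤ 1 / Real.sqrt x := by
  have h1 := Real.sqrt_pos.2 hx
  rw [le_div_iff₀ h1]
  nlinarith [Real.sq_sqrt hx.le, Real.sq_sqrt (show 0 ≤ x + 1 by linarith),
    sq_nonneg (Real.sqrt (x + 1) - Real.sqrt x)]

/-- Riemann sum of `min(1, b/√x)` on `[0, 1]`, whose integral is `b² + 2b(1 - b)`: the cap at `1` is
active up to `x = b²`, that is, on about the first `m` cells. -/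
theorem sum_min_one_sqrt_ge {b : ℝ} (hb0 : 0 ≤ b) (hb1 : b ≤ 1) {N : ℕ} (hN : 0 < N) :
    (2 * b - b ^ 2) * N - 1 - 2 * Real.sqrt N ≤
      ∑ i ∈ range N, min 1 (b * (Real.sqrt N / Real.sqrt (i + 1))) := by
  have hN' : (0 : ℝ) < N := by exact_mod_cast hN
  have hs := Real.sqrt_pos.2 hN'
  have hss := Real.sq_sqrt hN'.le
  set m := ⌊b ^ 2 * N⌋₊ with hm
  have hm1 : (m : ℝ) ≤ b ^ 2 * N := Nat.floor_le (by positivity)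
  have hm2 : b ^ 2 * N < m + 1 := Nat.lt_floor_add_one _
  have hmN : m ≤ N := by
    have : (m : ℝ) ≤ N := hm1.trans (by nlinarith [mul_le_one₀ hb1 hb0 hb1])
    exact_mod_cast this
  rw [← Finset.sum_range_add_sum_Ico _ hmN]
  have s1 : (m : ℝ) ≤ ∑ i ∈ range m, min 1 (b * (Real.sqrt N / Real.sqrt (i + 1))) := by
    calc (m : ℝ) = ∑ i ∈ range m, (1 : ℝ) := by simp
      _ ≤ _ := Finset.sum_le_sum fun i hi => le_min le_rfl ?_
    have hi' : (i : ℝ) + 1 ≤ m := by exact_mod_cast Finset.mem_range.1 hi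
    rw [← mul_div_assoc, le_div_iff₀ (Real.sqrt_pos.2 (by positivity)), one_mul]
    refine Real.sqrt_le_iff.2 ⟨by positivity, ?_⟩
    rw [mul_pow, hss]
    linarith
  have s2 : 2 * b * Real.sqrt N * (Real.sqrt (N + 1) - Real.sqrt (m + 1)) ≤
      ∑ i ∈ Finset.Ico m N, min 1 (b * (Real.sqrt N / Real.sqrt (i + 1))) := by
    have tel : ∑ i ∈ Finset.Ico m N, (Real.sqrt ((i + 1 : ℕ) + 1) - Real.sqrt (i + 1)) =
        Real.sqrt (N + 1) - Real.sqrt (m + 1) :=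
      Finset.sum_Ico_sub (fun i : ℕ => Real.sqrt (i + 1)) hmN
    rw [← tel, Finset.mul_sum]
    refine Finset.sum_le_sum fun i hi => ?_
    have hi' : (m : ℝ) ≤ i := by exact_mod_cast (Finset.mem_Ico.1 hi).1
    have hpos : (0 : ℝ) < i + 1 := by positivity
    have hle : b * (Real.sqrt N / Real.sqrt (i + 1)) ≤ 1 := by
      rw [← mul_div_assoc, div_le_one (Real.sqrt_pos.2 hpos)]
      refine Real.le_sqrt_of_sq_le ?_
      rw [mul_pow, hss]
      linarith
    rw [min_eq_right hle]
    have := mul_le_mul_of_nonneg_left (two_mul_sqrt_sub_le hpos) (mul_nonneg hb0 hs.le)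
    push_cast
    calc _ = b * Real.sqrt N * (2 * (Real.sqrt (i + 1 + 1) - Real.sqrt (i + 1))) := by ring
      _ ≤ _ := this
      _ = _ := by ring
  have s3 : Real.sqrt (m + 1) ≤ b * Real.sqrt N + 1 := by
    refine Real.sqrt_le_iff.2 ⟨by positivity, ?_⟩
    have : 0 ≤ b * Real.sqrt N := by positivity
    nlinarith
  have s4 : Real.sqrt N ≤ Real.sqrt (N + 1) := Real.sqrt_le_sqrt (by linarith)
  have s5 : 2 * b * Real.sqrt N * (Real.sqrt N - (b * Real.sqrt N + 1)) ≤
      2 * b * Real.sqrt N * (Real.sqrt (N + 1) - Real.sqrt (m + 1)) :=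
    mul_le_mul_of_nonneg_left (by linarith) (by positivity)
  have s6 : 2 * b * Real.sqrt N * (Real.sqrt N - (b * Real.sqrt N + 1)) =
      2 * b * N - 2 * b ^ 2 * N - 2 * b * Real.sqrt N := by
    linear_combination (2 * b - 2 * b ^ 2) * hss
  have s7 : b * Real.sqrt N ≤ Real.sqrt N := by nlinarith
  nlinarith

theorem hasThinSets_inv_sqrt {b : ℝ} (hb0 : 0 ≤ b) (hb1 : b ≤ 1) :
    HasThinSets (2 * b - b ^ 2) (Real.pi * b ^ 2) := by
  refine hasThinSets_of_densities (by positivity) fun η hη => Filter.Eventually.frequently ?_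
  -- Ensures `1 + 2√N ≤ 3√N ≤ η N`, which absorbs the error of the Riemann sum.
  have hev : ∀ᶠ N : ℕ in Filter.atTop, 3 / η ≤ Real.sqrt N :=
    (Real.tendsto_sqrt_atTop.comp tendsto_natCast_atTop_atTop).eventually_ge_atTop _
  filter_upwards [hev, Filter.eventually_ge_atTop 1] with N hNη hN
  have hN1 : (1 : ℝ) ≤ N := by exact_mod_cast hN
  have hss := Real.sq_sqrt (show (0 : ℝ) ≤ N by positivity)
  have hs1 : 1 ≤ Real.sqrt N := Real.one_le_sqrt.2 hN1
  set u : ℕ → ℝ := fun i => min 1 (b * (Real.sqrt N / Real.sqrt (i + 1))) with hu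
  have hu0 : ∀ i, 0 ≤ u i := fun i => le_min zero_le_one (by positivity)
  refine ⟨fun i => if i < N then u i else 0, fun i => ?_, fun i => ?_, fun i hi => ?_, ?_,
    fun k => ?_⟩
  · dsimp only; split
    exacts [hu0 i, le_rfl]
  · dsimp only; split
    exacts [min_le_left _ _, zero_le_one]
  · exact if_neg (by omega)
  · have h1 := sum_min_one_sqrt_ge hb0 hb1 hN
    rw [Finset.sum_congr rfl fun i hi => if_pos (Finset.mem_range.1 hi)]
    have h2 : 3 ≤ Real.sqrt N * η := (div_le_iff₀ hη).1 hNη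
    have h3 : 3 * Real.sqrt N ≤ η * N := by nlinarith
    simp only [hu]
    linarith
  · have hle : ∀ i, (if i < N then u i else 0) ≤ b * (Real.sqrt N / Real.sqrt (i + 1)) := by
      intro i
      split
      · exact min_le_right _ _
      · positivity
    calc _ ≤ ∑ i ∈ range (k + 1),
          b ^ 2 * N * (1 / Real.sqrt ((i + 1) * ((k - i : ℕ) + 1))) := by
          refine Finset.sum_le_sum fun i _ => ?_
          refine (mul_le_mul (hle i) (hle (k - i)) (by split; exacts [hu0 _, le_rfl])
            (by positivity)).trans_eq ?_
          rw [Real.sqrt_mul (by positivity)]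
          field_simp
          rw [hss]
      _ ≤ b ^ 2 * N * Real.pi := by
          rw [← Finset.mul_sum]
          exact mul_le_mul_of_nonneg_left (sum_inv_sqrt_mul_reflect_le_pi k) (by positivity)
      _ ≤ _ := by
          have : 0 ≤ η * N := by positivity
          linarith

theorem symDelta_le_pi_mul {ε : ℝ} (h0 : 0 ≤ ε) (h1 : ε ≤ 1) :
    symDelta ε ≤ Real.pi * ε ^ 2 / (1 + Real.sqrt (1 - ε)) ^ 2 := by
  have hs := Real.sq_sqrt (show 0 ≤ 1 - ε by linarith)
  have hs0 := Real.sqrt_nonneg (1 - ε)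
  set s := Real.sqrt (1 - ε)
  have hs1 : s ≤ 1 := by nlinarith
  -- `b = 1 - s` solves `2b - b² = ε` and equals `ε / (1 + s)`.
  have h := (hasThinSets_inv_sqrt (b := 1 - s) (by linarith) (by linarith)).symDelta_le
    (ε := ε) (by positivity) h0 (by nlinarith) h1
  have e1 : 2 * (1 - s) - (1 - s) ^ 2 = ε := by nlinarith
  rw [e1, sub_self, mul_zero, add_zero] at h
  refine h.trans_eq ?_
  rw [eq_div_iff (by positivity), show ε = (1 - s) * (1 + s) by nlinarith]
  ring

theorem abs_pi_mul_sub_le {ε : ℝ} (h0 : 0 ≤ ε) (h1 : ε ≤ 1) :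
    |Real.pi * ε ^ 2 / (1 + Real.sqrt (1 - ε)) ^ 2 - Real.pi / 4 * ε ^ 2| ≤
      Real.pi * ε ^ 3 := by
  have hs := Real.sq_sqrt (show 0 ≤ 1 - ε by linarith)
  have hs0 := Real.sqrt_nonneg (1 - ε)
  set s := Real.sqrt (1 - ε)
  have hs1 : s ≤ 1 := by nlinarith
  have e : Real.pi * ε ^ 2 / (1 + s) ^ 2 - Real.pi / 4 * ε ^ 2 =
      Real.pi * ε ^ 2 * ((1 - s) * (3 + s) / (4 * (1 + s) ^ 2)) := by
    field_simp
    ring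
  have hb : (1 - s) * (3 + s) / (4 * (1 + s) ^ 2) ≤ ε := by
    rw [div_le_iff₀ (by positivity), show ε = (1 - s) * (1 + s) by nlinarith, mul_assoc]
    refine mul_le_mul_of_nonneg_left ?_ (by linarith)
    nlinarith [sq_nonneg s, mul_nonneg hs0 (sq_nonneg s)]
  have hnn : 0 ≤ (1 - s) * (3 + s) / (4 * (1 + s) ^ 2) :=
    div_nonneg (mul_nonneg (by linarith) (by linarith)) (by positivity)
  rw [e, abs_of_nonneg (by positivity), show Real.pi * ε ^ 3 = Real.pi * ε ^ 2 * ε by ring]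
  gcongr

/-! ### The five estimates combined. -/

theorem theorem1 :
    ((∀ ε : ℝ, 11 / 16 ≤ ε → ε ≤ 1 → symDelta ε = 2 * ε - 1) ∧
      (∀ ε : ℝ, 1 / 2 ≤ ε → ε ≤ 11 / 16 → 2 * ε - 1 ≤ symDelta ε)) ∧
    (∀ ε : ℝ, 0 < ε → ε ≤ 1 → 0.591389 * ε ^ 2 ≤ symDelta ε) ∧
    (∀ ε : ℝ, 0 < ε → ε ≤ 1 → 0.5546 * ε ^ 2 + 0.088079 * ε ^ 3 ≤ symDelta ε) ∧
    (∀ ε : ℝ, 0 < ε → ε ≤ 11 / 16 →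
      symDelta ε ≤ 96 / 121 * ε ^ 2 ∧ 96 / 121 * ε ^ 2 < 0.7934 * ε ^ 2) ∧
    ((∀ ε : ℝ, 0 < ε → ε ≤ 1 →
        symDelta ε ≤ Real.pi * ε ^ 2 / (1 + Real.sqrt (1 - ε)) ^ 2) ∧
      (∃ K : ℝ, ∀ ε : ℝ, 0 < ε → ε ≤ 1 →
        |Real.pi * ε ^ 2 / (1 + Real.sqrt (1 - ε)) ^ 2 - Real.pi / 4 * ε ^ 2| ≤ K * ε ^ 3)) := by
  refine ⟨⟨fun ε h0 h1 => le_antisymm ?_ ?_, fun ε h0 h1 => ?_⟩, fun ε h0 h1 => ?_,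
    fun ε h0 h1 => ?_, fun ε h0 h1 => ⟨?_, ?_⟩, fun ε h0 h1 => symDelta_le_pi_mul h0.le h1,
    Real.pi, fun ε h0 h1 => abs_pi_mul_sub_le h0.le h1⟩
  -- At `11/16` the block bound is `3/8`, and `3/8 + 2(ε - 11/16) = 2ε - 1`.
  · refine ((hasThinSets_blocks (by norm_num) le_rfl).symDelta_le (by norm_num) (by linarith) h0
      h1).trans_eq ?_
    ring
  · exact two_mul_sub_one_le_symDelta (by linarith) h1
  · exact two_mul_sub_one_le_symDelta h0 (by linarith)
  · refine le_trans ?_ (mul_sq_le_symDelta h0 h1)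
    gcongr
    norm_num
  -- Up to `0.616` the cubic stays below `0.609 ε²`. Beyond it the cubic, convex and below `2ε - 1`
  -- at both ends of `[0.616, 1]`, stays below that line.
  · rcases le_total ε 0.616 with h | h
    · refine le_trans ?_ (mul_sq_le_symDelta h0 h1)
      have : ε ^ 2 * (0.5546 + 0.088079 * ε) ≤ ε ^ 2 * 0.609 := by
        gcongr
        norm_num at h ⊢
        linarith
      linarith
    · refine le_trans ?_ (two_mul_sub_one_le_symDelta (by norm_num at h ⊢; linarith) h1)
      have h2 : 0 ≤ ε - 77 / 125 := by norm_num at h; linarith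
      have h3 : 0 ≤ 1 - ε := by linarith
      norm_num
      nlinarith [mul_nonneg h2 h3, mul_nonneg h0.le (mul_nonneg h2 h3)]
  · refine ((hasThinSets_blocks h0.le h1).symDelta_le (by positivity) h0.le le_rfl
      (by linarith)).trans_eq ?_
    ring
  · gcongr
    norm_num
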